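/- \textbf{Setting.} Let $\mathcal X=\{0,1\}$ and let $\theta=(\theta_{i,j})$ be a complex $n\times n$ matrix. The double-edge normal factor graph $\mathsf N_{\mathrm{DE}}(\theta)$ lives on the complete bipartite graph with left nodes $i\in[n]$ and right nodes $j\in[n]$. For every edge $(i,j)$ there are a left variable $(x^{\mathrm L}_{i,j},x^{\mathrm L'}_{i,j})\in\mathcal X^2$ and a right variable $(x^{\mathrm R}_{i,j},x^{\mathrm R'}_{i,j})\in\mathcal X^2$. Each left (right) node carries the function that is $1$ if exactly one of the unprimed and exactly one of the primed left (right) variables at that node equals $1$, and $0$ otherwise. Each edge carries the function that is $0$ if its left and right variables differ and otherwise equals the entry of $\begin{bmatrix}1&\overline{\theta_{i,j}}\\ \theta_{i,j}&|\theta_{i,j}|^2\end{bmatrix}$ in the row given by the unprimed and the column given by the primed component of their common value. The partition sum $Z=Z(\mathsf N_{\mathrm{DE}}(\theta))$ is the sum over all configurations of the product of all these functions. The same definition gives the partition sum of any $2$-cover: a graph on two labelled copies of every node such that the projection to the complete bipartite graph is a homomorphism that maps the neighbourhood of every node bijectively onto the neighbourhood of its image, nodes and edges carrying the functions of their images. The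 degree-$2$ Bethe partition sum $Z_{\mathrm B,2}=Z_{\mathrm B,2}(\mathsf N_{\mathrm{DE}}(\theta))$ is the square root of the arithmetic average of the partition sums of all $2$-covers. For $n\in\mathbb N$ let $Z_n(z_1,z_2,\dots)=\frac1{n!}\sum_{\sigma\in\mathcal S_n}\prod_{k=1}^n z_k^{c_k(\sigma)}$, where $c_k(\sigma)$ is the number of cycles of length $k$ of $\sigma$ (fixed points count as cycles of length $1$). Let $\Psi_n(a,b,m)=(n!)^2Z_n$ with $z_1=a$ and $z_k=mb^k$ for $k\ge2$, and let $\psi_n(a,b,m,c)=(n!)^2Z_n$ with $z_1=a$ and $z_k=mb^k+c^k$ for $k\ge2$. \textbf{Statement.} Let $\mathcal D$ be a probability distribution on $\mathbb C$ with moments $\mu_{p,q}=\mathbb E_{t\sim\mathcal D}[t^p\,\overline{t^q}]$ such that $\mu_{2,2}<\infty$, $\mu_{1,0}=0$ and $\mu_{1,1}=|\mu_{2,0}|>0$. For every $n$ let $\theta=\theta^{(n)}$ be a random complex $n\times n$ matrix with i.i.d. entries of distribution $\mathcal D$. Then: (i) $\mathcal D$ is supported on a line through the origin: there is $\phi\in(-\pi,\pi)$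 such that $\mathcal D(e^{\mathrm i\phi}\mathbb R)=1$. (ii) For every $n\ge1$, $Z^2$ and $Z_{\mathrm B,2}^2$ are integrable, and $$\mathbb E[Z^2]=\psi_n(\mu_{2,2},\mu_{1,1}^2,2,|\mu_{2,0}|^2)=\Psi_n(\mu_{2,2},\mu_{1,1}^2,3),$$ $$\mathbb E[Z_{\mathrm B,2}^2]=\psi_n(\mu_{2,2},\mu_{1,1}^2,1,|\mu_{2,0}|^2)=\Psi_n(\mu_{2,2},\mu_{1,1}^2,2).$$ (iii) With $a=\mu_{2,2}$ and $b=\mu_{1,1}^2$, as $n\to\infty$, $$\sqrt{\frac{\mathbb E[Z^2]}{\mathbb E[Z_{\mathrm B,2}^2]}}\;\sim\;\sqrt{\frac1e\cdot\frac{\frac{(n+2)(n+1)}{2}-\frac{(a-3b)(n+1)}{b}+\frac{(a-3b)^2}{2b^2}}{(n+1)-\frac{a-2b}{b}}}\,,$$ where $f(n)\sim g(n)$ means $\lim_{n\to\infty}f(n)/g(n)=1$. -/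

import Mathlib

open MeasureTheory ProbabilityTheory Filter Topology

noncomputable section

namespace DENFG

/-! ### Graph covers -/

/-- `H` is a cover of `G` with projection `p`: the map `p` is a graph homomorphism which maps the
neighbourhood of every vertex `w` of `H` bijectively onto the neighbourhood of `p w`. -/
def IsCover {V W : Type*} (G : SimpleGraph V) (H : SimpleGraph W) (p : W → V) : Prop :=
  (∀ a b, H.Adj a b → G.Adj (p a) (p b)) ∧
    ∀ w, Set.BijOn p (H.neighborSet w) (G.neighborSet (p w))

/-- The `M`-covers of `G`. As usual the `M` vertices above `v` are the labelled vertices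
`(v, 0), …, (v, M - 1)`, and covers are not identified up to relabelling. -/
abbrev MCover {V : Type*} (G : SimpleGraph V) (M : ℕ) : Type _ :=
  {H : SimpleGraph (V × Fin M) // IsCover G H Prod.fst}

/-! ### The double-edge normal factor graph of a matrix, and its covers -/

/-- The check nodes: `Sum.inl i` is the `i`-th left one, `Sum.inr j` is the `j`-th right one. -/
abbrev Node (n : ℕ) : Type := Fin n ⊕ Fin n

/-- The complete bipartite graph on the check nodes. -/
abbrev baseGraph (n : ℕ) : SimpleGraph (Node n) := completeBipartiteGraph (Fin n) (Fin n)

open Classical in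
/-- The check node function of an ordinary normal factor graph: exactly one of the incident
binary variables equals `1`. -/
def checkFn {ι : Type*} (x : ι → Fin 2) : ℂ := if ∃! k, x k = 1 then 1 else 0

/-- The check node function of a double-edge normal factor graph. -/
def deCheckFn {ι : Type*} (x : ι → Fin 2 × Fin 2) : ℂ :=
  checkFn (fun k => (x k).1) * checkFn (fun k => (x k).2)

/-- The edge weight matrix of an entry `t`; rows are indexed by the unprimed variable, columns by
the primed one. -/
def weightMatrix (t : ℂ) : Matrix (Fin 2) (Fin 2) ℂ :=
  !![1, starRingEnd ℂ t; t, ((‖t‖ ^ 2 : ℝ) : ℂ)]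

/-- The edge weight function of an entry `t`, with arguments the left variable `x` and the right
variable `y`. -/
def edgeFn (t : ℂ) (x y : Fin 2 × Fin 2) : ℂ :=
  if x = y then weightMatrix t x.1 x.2 else 0

section PartitionSum

variable {n : ℕ} {W : Type*} [Fintype W]

/-- The global function of the double-edge normal factor graph with check nodes `W`, underlying
graph `H`, and types of check nodes and edges read off from the projection `p` to the base graph.
The variable `x d` sits at the end of the edge of `d` which is attached to the check node `d.fst`:
over the edge between left node `i` and right node `j`, the left-to-right dart `d` carries the left
variable `x d`, its reverse `d.symm` carries the right variable `x d.symm`, and the edge weight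
function is counted once, at the left-to-right dart. -/
def globalFn (θ : Matrix (Fin n) (Fin n) ℂ) (H : SimpleGraph W) (p : W → Node n)
    (x : H.Dart → Fin 2 × Fin 2) : ℂ :=
  open Classical in
  (∏ w : W, deCheckFn (fun d : {d : H.Dart // d.fst = w} => x d.1)) *
    ∏ d : H.Dart,
      match p d.fst, p d.snd with
      | Sum.inl i, Sum.inr j => edgeFn (θ i j) (x d) (x d.symm)
      | _, _ => 1

/-- The partition sum: the sum of the global function over all configurations. -/
def partitionSum (θ : Matrix (Fin n) (Fin n) ℂ) (H : SimpleGraph W) (p : W → Node n) : ℂ :=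
  open Classical in ∑ x : H.Dart → Fin 2 × Fin 2, globalFn θ H p x

end PartitionSum

/-- The partition sum of the double-edge normal factor graph of `θ`. -/
def Z {n : ℕ} (θ : Matrix (Fin n) (Fin n) ℂ) : ℂ := partitionSum θ (baseGraph n) id

/-- The degree-`M` Bethe partition sum: the `M`-th root of the arithmetic average of the partition
sums of all `M`-covers (principal complex root; the average is in fact a non-negative real, since
every cover splits into an unprimed and a primed, complex conjugate, part). -/
def bethe (M : ℕ) {n : ℕ} (θ : Matrix (Fin n) (Fin n) ℂ) : ℂ :=
  open Classical in
  ((∑ H : MCover (baseGraph n) M, partitionSum θ H.1 Prod.fst) /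
    (Fintype.card (MCover (baseGraph n) M) : ℂ)) ^ ((M : ℂ)⁻¹)

/-! ### Cycle index -/

/-- The cycle index of the symmetric group of degree `n`, evaluated at `z`; the multiplicity of `k`
in the cycle partition of `σ` is the number of cycles of length `k` (fixed points for `k = 1`). -/
def cycleIndex (n : ℕ) (z : ℕ → ℝ) : ℝ :=
  (1 / (n.factorial : ℝ)) *
    ∑ σ : Equiv.Perm (Fin n), ∏ k ∈ Finset.Icc 1 n, z k ^ (σ.partition.parts.count k)

/-- The function `ψ_n(a, b, m, c)`. -/
def smallPsi (n : ℕ) (a b m c : ℝ) : ℝ :=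
  (n.factorial : ℝ) ^ 2 * cycleIndex n (fun k => if k = 1 then a else m * b ^ k + c ^ k)

/-- The function `Ψ_n(a, b, m)`. -/
def bigPsi (n : ℕ) (a b m : ℝ) : ℝ :=
  (n.factorial : ℝ) ^ 2 * cycleIndex n (fun k => if k = 1 then a else m * b ^ k)

/-! ### Moments -/

/-- The mixed moment `μ_{p,q}` of a distribution on `ℂ`. -/
def moment (D : Measure ℂ) (p q : ℕ) : ℂ := ∫ z, z ^ p * starRingEnd ℂ (z ^ q) ∂D

end DENFG

end

namespace DENFG

/-! ### Squarefree algebra and permanents -/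

/-! The edge weight matrix has rank one, so every partition sum factors into the squared modulus of
a permanent: of `θ` for the base graph, of a lift of `θ` by 2×2 permutation blocks for a 2-cover.
The 2-covers are parametrized by `s : Fin n → Fin n → Fin 2`, so that averaging over them is
averaging over independent uniform bits, one per edge.

A permanent is the coefficient of the product of all variables in a product of linear forms in
square-zero variables. Hence `Z ^ 2` and the terms of `bethe 2 θ ^ 2` become a linear functional of
a product over rows `i`, each factor being a product of four linear forms. Rows are independent
(also in the bits `s i`), so the expectation is the `n`-th power of a single averaged row polynomial
(`integral_row_polynomials`). The mean-zero condition leaves only the case of four equal indices,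
with weight `a`, and two distinct pairs, with weight `b`; since `|μ_{2,0}| = μ_{1,1}`, the three
ways of pairing have the same weight.

The averaged row is a quadratic form made of `m` mutually orthogonal hyperbolic pairs: `m = 3` for
`Z` (one per pairing), but only `m = 2` after averaging over covers, because the two pairings of an
entry with a conjugate merge into one (`row_four`, `row_two_cover`). The `n`-th power of such a form
counts permutations with `m`-coloured cycles (`pow_sum_hyperbolic`), which is the cycle index with
`z_k = m b ^ k`.

For the asymptotics, expanding over sets of fixed points and applying Burnside's lemma gives
`cycleIndex / b ^ n = ∑ u ^ l / l! * multichoose m (n - l)` with `u = (a - m b) / b`, which is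
asymptotic to `exp u * n ^ (m - 1) / (m - 1)!`. The quotient of the cases `m = 3` and `m = 2`, like
the stated closed form, is asymptotic to `n / (2 e)`. The line in (i) comes from the equality case
of `|E[t ^ 2]| ≤ E[|t| ^ 2]`. -/

/-- There is a commutative algebra generated by square-zero elements `y i` in which `∏ i, y i` is
not zero. -/
theorem exists_squareZero_algebra (ι : Type) [Fintype ι] :
    ∃ (B : Type) (_ : CommRing B) (_ : Algebra ℂ B) (y : ι → B) (Λ : B →ₗ[ℂ] ℂ),
      (∀ i, y i * y i = 0) ∧ Λ (∏ i, y i) = 1 := by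
  classical
  let s : Set (ι →₀ ℕ) := Set.range fun i => Finsupp.single i 2
  let I : Ideal (MvPolynomial ι ℂ) := Ideal.span ((fun s => MvPolynomial.monomial s (1 : ℂ)) '' s)
  let y : ι → MvPolynomial ι ℂ ⧸ I := fun i => Ideal.Quotient.mk I (MvPolynomial.X i)
  have hne : ∏ i, y i ≠ 0 := by
    -- Membership in a monomial ideal is tested on monomials: `∏ X i` has all exponents equal to 1,
    -- so no `X i ^ 2` divides it.
    rw [← map_prod, Ne, Ideal.Quotient.eq_zero_iff_mem, MvPolynomial.mem_ideal_span_monomial_image]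
    intro h
    have hprod : (∏ i, MvPolynomial.X i : MvPolynomial ι ℂ)
        = MvPolynomial.monomial (∑ i, Finsupp.single i 1) 1 := by
      rw [MvPolynomial.monomial_sum_one]
      rfl
    have hmem : (∑ i, Finsupp.single i 1 : ι →₀ ℕ) ∈
        (∏ i, MvPolynomial.X i : MvPolynomial ι ℂ).support := by
      rw [hprod, MvPolynomial.mem_support_iff, MvPolynomial.coeff_monomial]
      simp
    obtain ⟨-, ⟨i, rfl⟩, hi⟩ := h _ hmem
    have := hi i
    simp [Finsupp.single_apply] at this
  obtain ⟨Λ, hΛ⟩ := not_forall.1 (mt (Module.forall_dual_apply_eq_zero_iff ℂ _).1 hne)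
  refine ⟨_, inferInstance, inferInstance, y, (Λ (∏ i, y i))⁻¹ • Λ, fun i => ?_, ?_⟩
  · rw [← map_mul, Ideal.Quotient.eq_zero_iff_mem]
    refine Ideal.subset_span ⟨_, ⟨i, rfl⟩, ?_⟩
    simp [MvPolynomial.X, MvPolynomial.monomial_mul, ← Finsupp.single_add]
  · simp [hΛ]

/-- A sum over all self-maps of a finite type whose terms vanish at the non-injective maps is a sum
over permutations. -/
theorem sum_fun_eq_sum_perm {T M : Type*} [Fintype T] [DecidableEq T] [AddCommMonoid M]
    (φ : (T → T) → M) (h : ∀ f, ¬ Function.Injective f → φ f = 0) :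
    ∑ f, φ f = ∑ σ : Equiv.Perm T, φ σ := by
  classical
  symm
  refine Finset.sum_of_injOn (fun σ : Equiv.Perm T => (σ : T → T))
    (fun σ _ τ _ hστ => DFunLike.coe_injective hστ) (fun _ _ => Finset.mem_coe.2 (Finset.mem_univ _)) ?_
    (fun _ _ => rfl)
  intro f _ hf
  refine h f fun hinj => hf ⟨Equiv.ofBijective f (Finite.injective_iff_bijective.1 hinj), by simp⟩

theorem prod_sum_smul {T K R B : Type*} [Fintype T] [DecidableEq T] [Fintype K] [CommRing R]
    [CommRing B] [Algebra R B] (A : T → K → R) (z : T → K → B) :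
    ∏ l, ∑ r, A l r • z l r = ∑ f : T → K, (∏ l, A l (f l)) • ∏ l, z l (f l) := by
  simp only [Finset.prod_univ_sum, Fintype.piFinset_univ, Finset.prod_smul]

theorem prod_eq_zero_of_not_injective {T K B : Type*} [Fintype T] [DecidableEq T] [CommRing B]
    (z : T → K → B) (hz : ∀ k k' r, z k r * z k' r = 0) (f : T → K)
    (hf : ¬ Function.Injective f) : ∏ k, z k (f k) = 0 := by
  simp only [Function.Injective, not_forall] at hf
  obtain ⟨k, k', h, hne⟩ := hf
  rw [← Finset.mul_prod_erase _ _ (Finset.mem_univ k),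
    ← Finset.mul_prod_erase _ _ (Finset.mem_erase.2 ⟨Ne.symm hne, Finset.mem_univ k'⟩), ← mul_assoc,
    ← h, hz, zero_mul]

/-- Expanding the product, a map hitting some `r` twice contributes `y r * y r = 0`; only
permutations survive, and each yields the full product of the variables. -/
theorem prod_sum_smul_eq_permanent {T R B : Type*} [Fintype T] [DecidableEq T] [CommRing R]
    [CommRing B] [Algebra R B] (A : T → T → R) (y : T → B) (hy : ∀ r, y r * y r = 0) :
    ∏ l, ∑ r, A l r • y r = (∑ σ : Equiv.Perm T, ∏ l, A l (σ l)) • ∏ r, y r := by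
  rw [prod_sum_smul, sum_fun_eq_sum_perm, Finset.sum_smul]
  · exact Finset.sum_congr rfl fun σ _ => by rw [Equiv.prod_comp σ y]
  · intro f hf
    rw [prod_eq_zero_of_not_injective (fun _ => y) (fun _ _ => hy) f hf, smul_zero]

/-- The sum over all permutations `τ` and all `m`-colourings `g` of the cycles of `τ` of the product
of the weights `w i (τ i)`. -/
noncomputable def colouredSum {R : Type*} [CommRing R] (n m : ℕ) (w : Fin n → Fin n → R) : R :=
  ∑ τ : Equiv.Perm (Fin n), ∑ g : Fin n → Fin m,
    if (∀ i, g (τ i) = g i) then ∏ i, w i (τ i) else 0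

/-- Expanding the power chooses for each factor `i` a colour `c i` and two indices `σ i`, `σ' i`.
Square-zero relations force `σ` and `σ'` to be permutations, and orthogonality of different colours
forces the two factors meeting at an index to have the same colour. So the colouring is constant on
the cycles of `σ' σ⁻¹`, and the `n!` choices of `σ` all contribute equally. -/
theorem pow_sum_hyperbolic {R B : Type*} [CommRing R] [CommRing B] [Algebra R B] {n m : ℕ}
    (w : Fin n → Fin n → R) (e e' : Fin m → Fin n → B) (F : Fin n → B)
    (he : ∀ c d j, e c j * e d j = 0) (he' : ∀ c d j, e' c j * e' d j = 0)
    (hee' : ∀ c d j, e c j * e' d j = if c = d then F j else 0) :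
    (∑ c, ∑ j, ∑ j', w j j' • (e c j * e' c j')) ^ n
      = (n.factorial * colouredSum n m w) • ∏ j, F j := by
  have h1 : (∑ c, ∑ j, ∑ j', w j j' • (e c j * e' c j')) ^ n
      = ∑ c : Fin n → Fin m, ∑ σ : Fin n → Fin n, ∑ σ' : Fin n → Fin n,
        (∏ i, w (σ i) (σ' i)) • ((∏ i, e (c i) (σ i)) * ∏ i, e' (c i) (σ' i)) := by
    rw [← Fin.prod_const]
    simp only [Finset.prod_univ_sum, Fintype.piFinset_univ, Finset.prod_smul,
      Finset.prod_mul_distrib]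
  have h2 : ∀ c : Fin n → Fin m, (∑ σ : Fin n → Fin n, ∑ σ' : Fin n → Fin n,
        (∏ i, w (σ i) (σ' i)) • ((∏ i, e (c i) (σ i)) * ∏ i, e' (c i) (σ' i)))
      = ∑ σ : Equiv.Perm (Fin n), ∑ σ' : Equiv.Perm (Fin n),
        (∏ i, w (σ i) (σ' i)) • ((∏ i, e (c i) (σ i)) * ∏ i, e' (c i) (σ' i)) := by
    intro c
    rw [sum_fun_eq_sum_perm]
    · refine Finset.sum_congr rfl fun σ _ => sum_fun_eq_sum_perm _ fun f hf => ?_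
      rw [prod_eq_zero_of_not_injective (fun i => e' (c i)) (fun _ _ => he' _ _) f hf, mul_zero,
        smul_zero]
    · intro f hf
      refine Finset.sum_eq_zero fun σ' _ => ?_
      rw [prod_eq_zero_of_not_injective (fun i => e (c i)) (fun _ _ => he _ _) f hf, zero_mul,
        smul_zero]
  have h3 : ∀ σ : Equiv.Perm (Fin n), (∑ c : Fin n → Fin m, ∑ σ' : Equiv.Perm (Fin n),
        (∏ i, w (σ i) (σ' i)) • ((∏ i, e (c i) (σ i)) * ∏ i, e' (c i) (σ' i)))
      = colouredSum n m w • ∏ j, F j := by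
    intro σ
    rw [Finset.sum_comm, colouredSum, Finset.sum_smul]
    -- Substitute `σ' = τ σ`, and below `c = g ∘ σ`; the sum over `τ` and `g` then no longer depends
    -- on `σ`.
    refine (Equiv.sum_comp (Equiv.mulRight σ) _).symm.trans ?_
    refine Finset.sum_congr rfl fun τ _ => ?_
    rw [Finset.sum_smul]
    refine (Equiv.sum_comp (Equiv.arrowCongr σ.symm (Equiv.refl (Fin m))) _).symm.trans ?_
    refine Finset.sum_congr rfl fun g _ => ?_
    simp only [Equiv.coe_mulRight, Equiv.Perm.mul_apply, Equiv.arrowCongr_apply, Equiv.symm_symm,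
      Equiv.coe_refl, Function.comp_apply, id]
    rw [Equiv.prod_comp σ fun i => w i (τ i), Equiv.prod_comp σ fun i => e (g i) i,
      Equiv.prod_comp σ fun i => e' (g i) (τ i)]
    have h4 : ∏ i, e' (g i) (τ i) = ∏ i, e' (g (τ.symm i)) i := by
      simpa using Equiv.prod_comp τ fun i => e' (g (τ.symm i)) i
    rw [h4, ← Finset.prod_mul_distrib]
    simp only [hee']
    have h5 : (∀ i, g (τ i) = g i) ↔ ∀ i, g i = g (τ.symm i) := by
      constructor
      · intro h i
        simpa using h (τ.symm i)
      · intro h i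
        simpa using h (τ i)
    by_cases hg : ∀ i, g (τ i) = g i
    · rw [if_pos hg, Finset.prod_congr rfl fun i _ => if_pos (h5.1 hg i)]
    · rw [if_neg hg, zero_smul]
      rw [Finset.prod_ite_zero, if_neg (by simpa using mt h5.2 hg), smul_zero]
  rw [h1, Finset.sum_congr rfl fun c _ => h2 c, Finset.sum_comm,
    Finset.sum_congr rfl fun σ _ => h3 σ, Finset.sum_const, Finset.card_univ, Fintype.card_perm,
    Fintype.card_fin, ← smul_assoc, nsmul_eq_mul]

/-! ### Row polynomials -/

/-- `a` if all four indices agree, `b` if they form two distinct pairs, and `0` otherwise. -/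
def pairing {R : Type*} [Zero R] {n : ℕ} (a b : R) (j₀ j₁ j₂ j₃ : Fin n) : R :=
  if j₁ = j₀ then (if j₃ = j₂ then (if j₂ = j₀ then a else b) else 0)
  else if (j₂ = j₀ ∧ j₃ = j₁) ∨ (j₂ = j₁ ∧ j₃ = j₀) then b else 0

theorem sum_pairing_smul {R B : Type*} [CommRing R] [CommRing B] [Algebra R B] {n : ℕ} (a b : R)
    (G : Fin n → Fin n → Fin n → Fin n → B) :
    ∑ j₀, ∑ j₁, ∑ j₂, ∑ j₃, pairing a b j₀ j₁ j₂ j₃ • G j₀ j₁ j₂ j₃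
      = ∑ j, ∑ j', if j' = j then a • G j j j j
          else b • (G j j j' j' + G j j' j j' + G j j' j' j) := by
  refine Finset.sum_congr rfl fun j _ => ?_
  -- One summand for each partner of the first index. The last two vanish on the diagonal, so the
  -- case of four equal indices is counted only in the first.
  have h1 : ∀ j₁ j₂ j₃, pairing a b j j₁ j₂ j₃ • G j j₁ j₂ j₃
      = (if j₁ = j then if j₃ = j₂ then (if j₂ = j then a • G j j j j else b • G j j j₂ j₂)
          else 0 else 0)
        + ((if j₂ = j then if j₃ = j₁ then if j₁ = j then 0 else b • G j j₁ j j₁ else 0 else 0)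
        + (if j₂ = j₁ then if j₃ = j then if j₁ = j then 0 else b • G j j₁ j₁ j else 0 else 0)) := by
    intro j₁ j₂ j₃
    unfold pairing
    split_ifs <;> simp_all
  simp only [h1, Finset.sum_add_distrib, Finset.sum_ite_irrel, Finset.sum_const_zero,
    Finset.sum_ite_eq', Finset.mem_univ, if_true]
  rw [← Finset.sum_add_distrib, ← Finset.sum_add_distrib]
  refine Finset.sum_congr rfl fun j' _ => ?_
  split_ifs
  · simp
  · simp only [smul_add, add_assoc]

/-- The weight of a pair of indices: `a / m` on the diagonal and `b` off the diagonal. -/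
def diagWeight {R : Type*} [DivisionRing R] (n m : ℕ) (a b : R) (j j' : Fin n) : R :=
  if j' = j then a / m else b

/-- Each of the three pairings of the four slots gives a hyperbolic pair: the pair containing slot 0
as `e`, its complement as `e'`. On the diagonal the three products coincide, so the weight `a` is
shared as three times `a / 3`. -/
theorem row_four {B : Type*} [CommRing B] [Algebra ℂ B] {n : ℕ} (a b : ℂ)
    (y : Fin n × Fin 4 → B) (hy : ∀ i, y i * y i = 0) :
    (∑ j₀, ∑ j₁, ∑ j₂, ∑ j₃,
      pairing a b j₀ j₁ j₂ j₃ • (y (j₀, 0) * y (j₁, 1) * (y (j₂, 2) * y (j₃, 3)))) ^ n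
      = (n.factorial * colouredSum n 3 (diagWeight n 3 a b)) • ∏ i, y i := by
  have hF : ∏ i, y i = ∏ j, (y (j, 0) * y (j, 1) * y (j, 2) * y (j, 3)) := by
    rw [Fintype.prod_prod_type]
    simp [Fin.prod_univ_four]
  rw [hF, ← pow_sum_hyperbolic (diagWeight n 3 a b)
    ![fun j => y (j, 0) * y (j, 1), fun j => y (j, 0) * y (j, 2), fun j => y (j, 0) * y (j, 3)]
    ![fun j => y (j, 2) * y (j, 3), fun j => y (j, 1) * y (j, 3), fun j => y (j, 1) * y (j, 2)]]
  · congr 1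
    rw [sum_pairing_smul a b fun j₀ j₁ j₂ j₃ => y (j₀, 0) * y (j₁, 1) * (y (j₂, 2) * y (j₃, 3))]
    simp only [Fin.sum_univ_three, Matrix.cons_val, ← Finset.sum_add_distrib, diagWeight]
    refine Finset.sum_congr rfl fun j _ => Finset.sum_congr rfl fun j' _ => ?_
    split_ifs with h
    · subst h
      rw [show y (j', 0) * y (j', 2) * (y (j', 1) * y (j', 3))
          = y (j', 0) * y (j', 1) * (y (j', 2) * y (j', 3)) by ring,
        show y (j', 0) * y (j', 3) * (y (j', 1) * y (j', 2))
          = y (j', 0) * y (j', 1) * (y (j', 2) * y (j', 3)) by ring, ← add_smul, ← add_smul]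
      congr 1
      push_cast
      ring
    · rw [← smul_add, ← smul_add]
      congr 1
      ring
  · intro c d j
    have h0 := hy (j, 0)
    fin_cases c <;> fin_cases d <;> simp <;> grind
  · intro c d j
    have h1 := hy (j, 1)
    have h2 := hy (j, 2)
    have h3 := hy (j, 3)
    fin_cases c <;> fin_cases d <;> simp <;> grind
  · intro c d j
    have h1 := hy (j, 1)
    have h2 := hy (j, 2)
    have h3 := hy (j, 3)
    fin_cases c <;> fin_cases d <;> simp <;> grind

/-- Two distinct coordinates of a uniform bit vector are independent, so the mean of the product is
the product of the means. -/
theorem sum_mul_two_coordinates {B : Type*} [CommRing B] [Algebra ℂ B] {n : ℕ} {j j' : Fin n}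
    (hj : j ≠ j') (h h' : Fin 2 → B) :
    ∑ s : Fin n → Fin 2, h (s j) * h' (s j') =
      (2 ^ n : ℂ) • (((1 / 2 : ℂ) • (h 0 + h 1)) * ((1 / 2 : ℂ) • (h' 0 + h' 1))) := by
  have key : ∀ (k : Fin n) (h : Fin 2 → B) (φ : (Fin n → Fin 2) → B)
      (_ : ∀ s, φ (s + Pi.single k 1) = φ s),
      ∑ s : Fin n → Fin 2, h (s k) * φ s = ∑ s, ((1 / 2 : ℂ) • (h 0 + h 1)) * φ s := by
    intro k h φ hφ
    have h1 : ∑ s : Fin n → Fin 2, h (s k) * φ s = ∑ s : Fin n → Fin 2, h (s k + 1) * φ s := by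
      rw [← Equiv.sum_comp (Equiv.addRight (Pi.single k 1))]
      simp [hφ]
    have h2 : ∀ u : Fin 2, h u + h (u + 1) = h 0 + h 1 := by
      intro u
      fin_cases u
      · rfl
      · exact add_comm _ _
    have h3 : ∑ s : Fin n → Fin 2, h (s k) * φ s
        = (1 / 2 : ℂ) • (∑ s : Fin n → Fin 2, h (s k) * φ s
          + ∑ s : Fin n → Fin 2, h (s k + 1) * φ s) := by
      rw [← h1, ← two_smul ℂ, smul_smul]
      norm_num
    rw [h3, ← Finset.sum_add_distrib, Finset.smul_sum]
    refine Finset.sum_congr rfl fun s _ => ?_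
    rw [← add_mul, h2, smul_mul_assoc]
  rw [key j h (fun s => h' (s j')) (by simp [Pi.single_eq_of_ne hj.symm])]
  have h4 := key j' h' (fun _ => (1 / 2 : ℂ) • (h 0 + h 1)) (by simp)
  simp only [mul_comm (h' _)] at h4
  rw [h4, Finset.sum_const, mul_comm, Finset.card_univ, Fintype.card_fun, Fintype.card_fin,
    Fintype.card_fin, ← Nat.cast_smul_eq_nsmul ℂ]
  push_cast
  rfl

/-- In the index of `y`, the first bit separates unprimed from primed and the second is the copy.
Pairing unprimed with unprimed does not see `s` and gives the first hyperbolic pair. The other two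
pairings average, off the diagonal, to `q j * q j' + t j * t j'`. Since `q ^ 2 = t ^ 2` and `q t =
0`, these combine into the single hyperbolic pair `q + i t`, `q - i t`. -/
theorem row_two_cover {B : Type*} [CommRing B] [Algebra ℂ B] {n : ℕ} (a b : ℂ)
    (y : Fin n × (Fin 2 × Fin 2) → B) (hy : ∀ i, y i * y i = 0) :
    ((2 ^ n : ℂ)⁻¹ • ∑ s : Fin n → Fin 2, ∑ j₀, ∑ j₁, ∑ j₂, ∑ j₃,
      pairing a b j₀ j₁ j₂ j₃ • (y (j₀, 0, 0 + s j₀) * y (j₁, 0, 1 + s j₁) *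
        (y (j₂, 1, 0 + s j₂) * y (j₃, 1, 1 + s j₃)))) ^ n
      = (n.factorial * colouredSum n 2 (diagWeight n 2 a b)) • ∏ i, y i := by
  have hF : ∏ i, y i = ∏ j, (y (j, 0, 0) * y (j, 0, 1) * (y (j, 1, 0) * y (j, 1, 1))) := by
    rw [Fintype.prod_prod_type]
    simp [Fintype.prod_prod_type, Fin.prod_univ_two]
  let u : Fin n → Fin 2 → B := fun j k => y (j, 0, k) * y (j, 1, k)
  let v : Fin n → Fin 2 → B := fun j k => y (j, 0, k) * y (j, 1, k + 1)
  let q : Fin n → B := fun j => (1 / 2 : ℂ) • (u j 0 + u j 1)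
  let t : Fin n → B := fun j => (1 / 2 : ℂ) • (v j 0 + v j 1)
  let I : B := algebraMap ℂ B Complex.I
  have hI : I * I = -1 := by
    rw [← map_mul, Complex.I_mul_I, map_neg, map_one]
  have huu : ∀ j, (u j 0 + u j 1) * (u j 0 + u j 1)
      = 2 * (y (j, 0, 0) * y (j, 0, 1) * (y (j, 1, 0) * y (j, 1, 1))) := by
    intro j
    have h0 := hy (j, 0, 0)
    have h1 := hy (j, 0, 1)
    simp only [u]
    grind
  have hvv : ∀ j, (v j 0 + v j 1) * (v j 0 + v j 1)
      = 2 * (y (j, 0, 0) * y (j, 0, 1) * (y (j, 1, 0) * y (j, 1, 1))) := by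
    intro j
    have h0 := hy (j, 0, 0)
    have h1 := hy (j, 0, 1)
    simp only [v, Fin.isValue, zero_add, Fin.reduceAdd]
    grind
  have huv : ∀ j, (u j 0 + u j 1) * (v j 0 + v j 1) = 0 := by
    intro j
    have h0 := hy (j, 0, 0)
    have h1 := hy (j, 0, 1)
    have h2 := hy (j, 1, 0)
    have h3 := hy (j, 1, 1)
    simp only [u, v, Fin.isValue, zero_add, Fin.reduceAdd]
    grind
  have hqq : ∀ j, q j * q j + t j * t j
      = y (j, 0, 0) * y (j, 0, 1) * (y (j, 1, 0) * y (j, 1, 1)) := by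
    intro j
    simp only [q, t, smul_mul_smul_comm, huu, hvv]
    rw [two_mul]
    module
  have hqt : ∀ j, q j * t j = 0 := by
    intro j
    simp only [q, t, smul_mul_smul_comm, huv, smul_zero]
  have hqt' : ∀ j, q j * q j = t j * t j := by
    intro j
    simp only [q, t, smul_mul_smul_comm, huu, hvv]
  have hqp : ∀ j, y (j, 0, 0) * y (j, 0, 1) * q j = 0 ∧ y (j, 0, 0) * y (j, 0, 1) * t j = 0 ∧
      y (j, 1, 0) * y (j, 1, 1) * q j = 0 ∧ y (j, 1, 0) * y (j, 1, 1) * t j = 0 := by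
    intro j
    have h0 := hy (j, 0, 0)
    have h1 := hy (j, 0, 1)
    have h2 := hy (j, 1, 0)
    have h3 := hy (j, 1, 1)
    simp only [q, t, u, v, Fin.isValue, zero_add, Fin.reduceAdd, mul_smul_comm]
    refine ⟨?_, ?_, ?_, ?_⟩ <;> convert smul_zero (1 / 2 : ℂ) using 2 <;> grind
  rw [hF, ← pow_sum_hyperbolic (diagWeight n 2 a b)
    ![fun j => y (j, 0, 0) * y (j, 0, 1), fun j => q j + I * t j]
    ![fun j => y (j, 1, 0) * y (j, 1, 1), fun j => q j - I * t j]]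
  · congr 1
    have hs : ∀ s : Fin n → Fin 2, (∑ j₀, ∑ j₁, ∑ j₂, ∑ j₃,
        pairing a b j₀ j₁ j₂ j₃ • (y (j₀, 0, 0 + s j₀) * y (j₁, 0, 1 + s j₁) *
          (y (j₂, 1, 0 + s j₂) * y (j₃, 1, 1 + s j₃))))
        = ∑ j, ∑ j', if j' = j then
            a • (y (j, 0, 0) * y (j, 0, 1) * (y (j, 1, 0) * y (j, 1, 1)))
          else b • (y (j, 0, 0) * y (j, 0, 1) * (y (j', 1, 0) * y (j', 1, 1))
            + u j (s j) * u j' (s j' + 1) + v j (s j) * v j' (s j' + 1)) := by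
      intro s
      have h01 : ∀ (w : Fin 2) (j : Fin n) (k : Fin 2),
          y (j, w, k) * y (j, w, k + 1) = y (j, w, 0) * y (j, w, 1) := by
        intro w j k
        fin_cases k
        · rfl
        · exact mul_comm _ _
      rw [sum_pairing_smul a b fun j₀ j₁ j₂ j₃ => y (j₀, 0, 0 + s j₀) * y (j₁, 0, 1 + s j₁) *
          (y (j₂, 1, 0 + s j₂) * y (j₃, 1, 1 + s j₃))]
      simp only [zero_add, add_comm (1 : Fin 2), h01]
      refine Finset.sum_congr rfl fun j _ => Finset.sum_congr rfl fun j' _ => ?_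
      have h11 : s j' + 1 + 1 = s j' := by
        rw [add_assoc]
        exact add_zero _
      simp only [u, v, h11]
      congr 3
      · congr 1
        ring
      · ring
    have h2n : (2 ^ n : ℂ) ≠ 0 := pow_ne_zero _ two_ne_zero
    have hconst : ∀ x : B, (2 ^ n : ℂ)⁻¹ • ∑ _s : Fin n → Fin 2, x = x := by
      intro x
      rw [Finset.sum_const, Finset.card_univ, Fintype.card_fun, Fintype.card_fin,
        Fintype.card_fin, ← Nat.cast_smul_eq_nsmul ℂ, smul_smul]
      push_cast
      rw [inv_mul_cancel₀ h2n, one_smul]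
    -- `(q j + I t j) (q j' - I t j')` differs from `q j q j' + t j t j'` by a term antisymmetric in
    -- `j, j'`, which the symmetric weight cancels; it is added to the other side as this zero.
    have hanti : ∑ j, ∑ j', diagWeight n 2 a b j j' • (I * (t j * q j' - q j * t j')) = 0 := by
      simp only [mul_sub, smul_sub, Finset.sum_sub_distrib]
      rw [sub_eq_zero, Finset.sum_comm]
      refine Finset.sum_congr rfl fun j _ => Finset.sum_congr rfl fun j' _ => ?_
      rw [mul_comm (t j')]
      simp only [diagWeight, eq_comm]
    rw [Finset.sum_congr rfl fun s _ => hs s, Finset.sum_comm, ← add_zero (_ • _), ← hanti]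
    simp only [Fin.sum_univ_two, Matrix.cons_val, ← Finset.sum_add_distrib]
    rw [Finset.smul_sum, ← Finset.sum_add_distrib]
    refine Finset.sum_congr rfl fun j _ => ?_
    rw [Finset.sum_comm, Finset.smul_sum, ← Finset.sum_add_distrib]
    refine Finset.sum_congr rfl fun j' _ => ?_
    have hc : (q j + I * t j) * (q j' - I * t j')
        = q j * q j' + t j * t j' + I * (t j * q j' - q j * t j') := by
      linear_combination (- t j * t j') * hI
    rw [hc, smul_add _ _ (I * _), ← add_assoc, add_left_inj]
    by_cases h : j' = j
    · subst h
      simp only [if_true, diagWeight]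
      rw [hconst, hqq, ← add_smul]
      congr 1
      push_cast
      ring
    · simp only [if_neg h, diagWeight]
      rw [← Finset.smul_sum, smul_comm, ← smul_add]
      congr 1
      simp only [Finset.sum_add_distrib, smul_add]
      rw [hconst, sum_mul_two_coordinates (Ne.symm h) (u j) fun k => u j' (k + 1),
        sum_mul_two_coordinates (Ne.symm h) (v j) fun k => v j' (k + 1), inv_smul_smul₀ h2n,
        inv_smul_smul₀ h2n, add_assoc]
      simp only [q, t, zero_add, Fin.isValue, Fin.reduceAdd, add_comm (u j' 1), add_comm (v j' 1)]
  · intro c d j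
    have h0 := hy (j, 0, 0)
    obtain ⟨h1, h2, h3, h4⟩ := hqp j
    have h5 := hqt j
    have h6 := hqt' j
    fin_cases c <;> fin_cases d <;> simp <;> grind
  · intro c d j
    have h0 := hy (j, 1, 0)
    obtain ⟨h1, h2, h3, h4⟩ := hqp j
    have h5 := hqt j
    have h6 := hqt' j
    fin_cases c <;> fin_cases d <;> simp <;> grind
  · intro c d j
    obtain ⟨h1, h2, h3, h4⟩ := hqp j
    have h5 := hqq j
    fin_cases c <;> fin_cases d <;> simp <;> grind

/-! ### Cycle index and coloured permutations -/

/-- `cycleType` omits fixed points, so these are added as separate classes: a class is sent either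
to its fixed point or to its cycle factor. -/
theorem card_quotient_sameCycle {T : Type*} [Fintype T] [DecidableEq T] (τ : Equiv.Perm T)
    [Fintype (Quotient (Equiv.Perm.SameCycle.setoid τ))] :
    Fintype.card (Quotient (Equiv.Perm.SameCycle.setoid τ))
      = τ.cycleType.card + (Fintype.card T - τ.support.card) := by
  classical
  have hcard : τ.cycleType.card + (Fintype.card T - τ.support.card)
      = (τ.cycleFactorsFinset.disjSum τ.supportᶜ).card := by
    rw [Finset.card_disjSum, Equiv.Perm.cycleType_def, Multiset.card_map, Finset.card_compl]
    rfl
  rw [hcard, ← Finset.card_univ]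
  have hfix : ∀ x y, τ.SameCycle x y → τ x = x → x = y := by
    rintro x y ⟨k, rfl⟩ hx
    exact (Equiv.Perm.zpow_apply_eq_self_of_apply_eq_self hx k).symm
  refine Finset.card_bij
    (fun q _ => Quotient.lift
      (fun x => if τ x = x then (Sum.inr x : Equiv.Perm T ⊕ T) else Sum.inl (τ.cycleOf x))
      (fun x y (h : τ.SameCycle x y) => ?_) q) ?_ ?_ ?_
  · by_cases hx : τ x = x
    · rw [hfix x y h hx]
    · have hy : τ y ≠ y := fun hy => hx (by rw [hfix y x h.symm hy] at hy; exact hy)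
      simp only [if_neg hx, if_neg hy, h.cycleOf_eq]
  · intro q _
    induction q using Quotient.inductionOn with
    | h x =>
      simp only [Quotient.lift_mk, Finset.mem_disjSum]
      split_ifs with hx
      · exact Or.inr ⟨x, by simpa using hx, rfl⟩
      · exact Or.inl ⟨_, Equiv.Perm.cycleOf_mem_cycleFactorsFinset_iff.2 (by simpa using hx), rfl⟩
  · intro q _ q' _
    induction q using Quotient.inductionOn with
    | h x =>
    induction q' using Quotient.inductionOn with
    | h y =>
      simp only [Quotient.lift_mk]
      intro h
      split_ifs at h with hx hy hy
      · rw [Sum.inr.inj h]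
      · exact Quotient.sound ((Equiv.Perm.sameCycle_iff_cycleOf_eq_of_mem_support
          (by simpa using hx) (by simpa using hy)).2 (Sum.inl.inj h))
  · intro z hz
    rw [Finset.mem_disjSum] at hz
    rcases hz with ⟨c, hc, rfl⟩ | ⟨x, hx, rfl⟩
    · obtain ⟨x, hx⟩ := (Equiv.Perm.mem_cycleFactorsFinset_iff.1 hc).1.nonempty_support
      have hx' : τ x ≠ x := by
        have := Equiv.Perm.mem_cycleFactorsFinset_support_le hc hx
        simpa using this
      refine ⟨Quotient.mk _ x, Finset.mem_univ _, ?_⟩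
      simp only [Quotient.lift_mk, if_neg hx']
      rw [Equiv.Perm.cycle_is_cycleOf hx hc]
    · refine ⟨Quotient.mk _ x, Finset.mem_univ _, ?_⟩
      simp only [Quotient.lift_mk]
      rw [if_pos (by simpa using hx)]

/-- An invariant colouring is a free choice of a colour on each cycle, fixed points included. -/
theorem card_invariant_colourings {T : Type*} [Fintype T] [DecidableEq T] (m : ℕ)
    (τ : Equiv.Perm T) :
    (Finset.univ.filter fun g : T → Fin m => ∀ i, g (τ i) = g i).card
      = m ^ (τ.cycleType.card + (Fintype.card T - τ.support.card)) := by
  classical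
  have : Fintype (Quotient (Equiv.Perm.SameCycle.setoid τ)) := Fintype.ofFinite _
  rw [← card_quotient_sameCycle τ, ← Fintype.card_subtype]
  conv_rhs => rw [← Fintype.card_fin m]
  rw [← Fintype.card_fun]
  refine Fintype.card_congr
    ⟨fun g => Quotient.lift g.1 ?_, fun h => ⟨fun x => h (Quotient.mk _ x), fun i => ?_⟩,
      fun g => ?_, fun h => ?_⟩
  · rintro x y ⟨k, rfl⟩
    have h1 : ∀ (k : ℕ) x, g.1 ((τ ^ k) x) = g.1 x := by
      intro k
      induction k with
      | zero => simp
      | succ k ih =>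
        intro x
        rw [pow_succ, Equiv.Perm.mul_apply, ih, g.2]
    obtain ⟨l, rfl | rfl⟩ := Int.eq_nat_or_neg k
    · rw [zpow_natCast, h1]
    · rw [← h1 l ((τ ^ (-(l : ℤ))) x), ← zpow_natCast, ← Equiv.Perm.mul_apply]
      simp
  · exact congrArg h <| Quotient.sound (s := Equiv.Perm.SameCycle.setoid τ)
      (show τ.SameCycle (τ i) i from ⟨-1, by simp⟩)
  · rfl
  · funext q
    induction q using Quotient.inductionOn with
    | h x => rfl

/-- Summing over colours gives a factor `m` per cycle. A cycle of length `k ≥ 2` thus contributes `m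
* b ^ k`, and a fixed point `m * (a / m) = a`, which is why the diagonal weight is divided by `m`.
-/
theorem factorial_mul_cycleIndex (n m : ℕ) (hm : m ≠ 0) (a b : ℝ) :
    n.factorial * cycleIndex n (fun k => if k = 1 then a else m * b ^ k)
      = colouredSum n m (diagWeight n m a b) := by
  classical
  have hn : (n.factorial : ℝ) ≠ 0 := by positivity
  rw [cycleIndex, ← mul_assoc, mul_one_div_cancel hn, one_mul, colouredSum]
  refine Finset.sum_congr rfl fun τ _ => ?_
  have hsub : τ.partition.parts.toFinset ⊆ Finset.Icc 1 n := by
    intro k hk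
    rw [Multiset.mem_toFinset] at hk
    rw [Finset.mem_Icc]
    refine ⟨τ.partition.parts_pos hk, ?_⟩
    simpa using (Multiset.le_sum_of_mem hk).trans_eq τ.partition.parts_sum
  -- Lengths in `1, …, n` that do not occur contribute `z k ^ 0 = 1`, so the product runs over the
  -- parts: the cycle lengths together with a 1 for each fixed point.
  rw [← Finset.prod_subset hsub, ← Finset.prod_multiset_map_count, Equiv.Perm.parts_partition,
    Multiset.map_add, Multiset.prod_add, Multiset.map_replicate, Multiset.prod_replicate,
    if_pos rfl]
  · have h1 : ∀ M : Multiset ℕ, (∀ k ∈ M, k ≠ 1) →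
        (M.map fun k => if k = 1 then a else (m : ℝ) * b ^ k).prod = m ^ M.card * b ^ M.sum := by
      intro M
      induction M using Multiset.induction with
      | empty => simp
      | cons k M ih =>
        intro h
        rw [Multiset.map_cons, Multiset.prod_cons, ih fun k hk => h k (Multiset.mem_cons_of_mem hk),
          if_neg (h k (Multiset.mem_cons_self k M)), Multiset.card_cons, Multiset.sum_cons]
        ring
    have h3 : (Finset.univ.filter fun g : Fin n → Fin m => ∀ i, g (τ i) = g i).card
        = m ^ (τ.cycleType.card + (Fintype.card (Fin n) - τ.support.card)) := by
      convert! card_invariant_colourings m τ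
    rw [h1 _ fun k hk => Nat.ne_of_gt (Equiv.Perm.two_le_of_mem_cycleType hk), Equiv.Perm.sum_cycleType,
      ← Finset.sum_filter, Finset.sum_const, h3]
    have h2 : ∏ i, diagWeight n m a b i (τ i) = (a / m) ^ (Fintype.card (Fin n) - τ.support.card)
        * b ^ τ.support.card := by
      simp only [diagWeight]
      rw [Finset.prod_ite, Finset.prod_const, Finset.prod_const, ← Finset.card_compl]
      congr 3
      ext i
      simp
    rw [h2, nsmul_eq_mul]
    push_cast
    rw [pow_add, div_pow]
    field_simp
  · intro k _ hk
    rw [Multiset.count_eq_zero.2 (by simpa using hk), pow_zero]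

/-- Burnside's lemma for permutations acting on colourings by precomposition: an orbit is determined
by its multiset of colours. -/
theorem sum_card_invariant_colourings {T : Type*} [Fintype T] [DecidableEq T] (m : ℕ) :
    ∑ τ : Equiv.Perm T,
      (Finset.univ.filter fun g : T → Fin m => ∀ i, g (τ i) = g i).card
      = (Fintype.card T).factorial * m.multichoose (Fintype.card T) := by
  classical
  let X := T → Fin m
  have : Fintype (Equiv.Perm T)ᵈᵐᵃ := Fintype.ofEquiv _ DomMulAct.mk
  have hB := MulAction.sum_card_fixedBy_eq_card_orbits_mul_card_group (Equiv.Perm T)ᵈᵐᵃ X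
  have hG : Fintype.card (Equiv.Perm T)ᵈᵐᵃ = (Fintype.card T).factorial := by
    rw [← Fintype.card_congr (DomMulAct.mk (M := Equiv.Perm T)),
      Fintype.card_perm]
  have hO : Fintype.card (Quotient (MulAction.orbitRel (Equiv.Perm T)ᵈᵐᵃ X))
      = m.multichoose (Fintype.card T) := by
    conv_rhs => rw [← Fintype.card_fin m]
    rw [← Sym.card_sym_eq_multichoose]
    let φ : X → Sym (Fin m) (Fintype.card T) := fun g => ⟨Finset.univ.val.map g, by simp⟩
    have hφ : ∀ g g' : X, φ g = φ g' ↔ MulAction.orbitRel (Equiv.Perm T)ᵈᵐᵃ X g g' := by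
      intro g g'
      rw [MulAction.orbitRel_apply, MulAction.mem_orbit_iff]
      constructor
      · intro h
        have h1 : Finset.univ.val.map g = Finset.univ.val.map g' := congrArg Subtype.val h
        have h2 : ∀ (g : X) c, Fintype.card {i // g i = c} = (Finset.univ.val.map g).count c := by
          intro g c
          rw [Fintype.card_subtype, Multiset.count_map]
          simp only [eq_comm]
          rfl
        have h3 : ∀ c, Nonempty ({i // g i = c} ≃ {i // g' i = c}) := fun c =>
          Fintype.card_eq.1 (by rw [h2, h2, h1])
        let e := fun c => (h3 c).some
        -- Equal multisets mean equally large colour classes; bijections between the classes glue to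
        -- a permutation.
        refine ⟨DomMulAct.mk (Equiv.ofFiberEquiv e), ?_⟩
        funext i
        exact Equiv.ofFiberEquiv_map e i
      · rintro ⟨σ, rfl⟩
        refine Subtype.ext ?_
        change Finset.univ.val.map (g' ∘ (DomMulAct.mk.symm σ : Equiv.Perm T)) = Finset.univ.val.map g'
        rw [← Multiset.map_map, Multiset.map_univ_val_equiv]
    refine Fintype.card_congr (Equiv.ofBijective
      (Quotient.lift φ fun g g' h => (hφ g g').2 h) ⟨?_, ?_⟩)
    · intro q q'
      induction q using Quotient.inductionOn
      induction q' using Quotient.inductionOn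
      exact fun h => Quotient.sound ((hφ _ _).1 h)
    · rintro ⟨s, hs⟩
      obtain ⟨l, rfl⟩ := Quot.exists_rep s
      have hl : l.length = Fintype.card T := hs
      refine ⟨Quotient.mk _ (l.get ∘ Fintype.equivFinOfCardEq hl.symm), Subtype.ext ?_⟩
      change Finset.univ.val.map (l.get ∘ Fintype.equivFinOfCardEq hl.symm) = _
      rw [← Multiset.map_map, Multiset.map_univ_val_equiv]
      simp
  rw [hG, hO] at hB
  rw [mul_comm, ← hB, ← Equiv.sum_comp DomMulAct.mk]
  refine Finset.sum_congr rfl fun τ _ => ?_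
  rw [← Fintype.card_subtype]
  refine Fintype.card_congr (Equiv.subtypeEquivRight fun g => ?_)
  rw [MulAction.mem_fixedBy, funext_iff]
  rfl

/-- Writing the weight as `b` plus a correction `a / m - b` at fixed points and expanding gives a
sum over sets `S` of prescribed fixed points. What remains is an unweighted count of coloured
permutations of the complement, known from Burnside, times `m ^ |S|` for the colours on `S`. -/
theorem colouredSum_diagWeight (n m : ℕ) (hm : m ≠ 0) (a b : ℝ) :
    colouredSum n m (diagWeight n m a b) = ∑ l ∈ Finset.range (n + 1), (n.choose l : ℝ) *
      ((a - m * b) ^ l * b ^ (n - l) * ((n - l).factorial * m.multichoose (n - l))) := by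
  classical
  have hm' : (m : ℝ) ≠ 0 := Nat.cast_ne_zero.2 hm
  have hprod : ∀ τ : Equiv.Perm (Fin n), ∏ i, diagWeight n m a b i (τ i)
      = ∑ S : Finset (Fin n), if (∀ i ∈ S, τ i = i) then (a / m - b) ^ S.card * b ^ (n - S.card)
        else 0 := by
    intro τ
    have h1 : ∀ i, diagWeight n m a b i (τ i) = (if τ i = i then a / m - b else 0) + b := by
      intro i
      unfold diagWeight
      split_ifs <;> simp
    simp only [h1]
    rw [Fintype.prod_add]
    refine Finset.sum_congr rfl fun S _ => ?_
    rw [Finset.prod_ite_zero, Finset.prod_const, Finset.prod_const, Finset.card_compl,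
      Fintype.card_fin, ite_mul, zero_mul]
    congr
  have hcount : ∀ S : Finset (Fin n), (∑ τ : Equiv.Perm (Fin n), ∑ g : Fin n → Fin m,
      if (∀ i ∈ S, τ i = i) ∧ (∀ i, g (τ i) = g i) then (1 : ℝ) else 0)
      = m ^ S.card * ((n - S.card).factorial * m.multichoose (n - S.card)) := by
    intro S
    have hcard : Fintype.card {i // i ∉ S} = n - S.card := by
      simp [Fintype.card_subtype_compl]
    have h1 : ∀ τ : Equiv.Perm (Fin n), (∑ g : Fin n → Fin m,
        if (∀ i ∈ S, τ i = i) ∧ (∀ i, g (τ i) = g i) then (1 : ℝ) else 0)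
        = if ∀ i, ¬ i ∉ S → τ i = i then
            (m : ℝ) ^ (τ.cycleType.card + (Fintype.card (Fin n) - τ.support.card)) else 0 := by
      intro τ
      by_cases h : ∀ i ∈ S, τ i = i
      · rw [if_pos fun i hi => h i (not_not.1 hi)]
        simp only [and_iff_right h]
        rw [← Nat.cast_pow, ← card_invariant_colourings m τ, Finset.sum_boole]
        congr!
      · rw [if_neg fun h' => h fun i hi => h' i (not_not.2 hi)]
        simp [h]
    have h4 := sum_card_invariant_colourings (T := {i // i ∉ S}) m
    rw [hcard] at h4
    -- Permutations fixing `S` pointwise are the permutations of the complement of `S`.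
    rw [Finset.sum_congr rfl fun τ _ => h1 τ, ← Finset.sum_filter,
      Finset.sum_subtype (p := fun τ : Equiv.Perm (Fin n) => ∀ i, ¬ i ∉ S → τ i = i) _ (by simp),
      ← Equiv.sum_comp (Equiv.Perm.subtypeEquivSubtypePerm fun i => i ∉ S), ← Nat.cast_mul, ← h4,
      Nat.cast_sum, Finset.mul_sum]
    refine Finset.sum_congr rfl fun ρ _ => ?_
    have h5 : (Equiv.Perm.ofSubtype ρ).support.card = ρ.support.card := by
      rw [← Equiv.Perm.sum_cycleType, Equiv.Perm.cycleType_ofSubtype, Equiv.Perm.sum_cycleType]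
    have h6 : ρ.support.card ≤ n - S.card := hcard ▸ Finset.card_le_univ _
    have h7 : S.card ≤ n := by simpa using Finset.card_le_univ S
    rw [Equiv.Perm.subtypeEquivSubtypePerm_apply_coe, Equiv.Perm.cycleType_ofSubtype, h5,
      card_invariant_colourings, hcard, Fintype.card_fin, Nat.cast_pow, ← pow_add]
    congr 1
    omega
  rw [colouredSum]
  calc (∑ τ : Equiv.Perm (Fin n), ∑ g : Fin n → Fin m,
        if (∀ i, g (τ i) = g i) then ∏ i, diagWeight n m a b i (τ i) else 0)
      = ∑ S : Finset (Fin n), (a / m - b) ^ S.card * b ^ (n - S.card) *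
        ∑ τ : Equiv.Perm (Fin n), ∑ g : Fin n → Fin m,
          if (∀ i ∈ S, τ i = i) ∧ (∀ i, g (τ i) = g i) then (1 : ℝ) else 0 := by
        simp only [Finset.mul_sum]
        refine Eq.symm (Finset.sum_comm.trans (Finset.sum_congr rfl fun τ _ =>
          Finset.sum_comm.trans (Finset.sum_congr rfl fun g _ => ?_)))
        split_ifs with h
        · rw [hprod]
          refine Finset.sum_congr rfl fun S _ => ?_
          simp [h]
        · simp [h]
    _ = ∑ S ∈ (Finset.univ : Finset (Fin n)).powerset, (fun l : ℕ =>
        (a - m * b) ^ l * b ^ (n - l) * ((n - l).factorial * m.multichoose (n - l))) S.card := by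
        rw [Finset.powerset_univ]
        refine Finset.sum_congr rfl fun S _ => ?_
        rw [hcount]
        have h2 : a - m * b = (a / m - b) * m := by
          field_simp
        simp only [h2, mul_pow]
        ring
    _ = _ := by
        rw [Finset.sum_powerset_apply_card fun l : ℕ => (a - m * b) ^ l * b ^ (n - l) *
          ((n - l).factorial * m.multichoose (n - l)), Finset.card_univ, Fintype.card_fin]
        simp only [nsmul_eq_mul]

/-! ### Asymptotics of the cycle index -/

/-- Dominated convergence for series: for fixed `l` the shift from `n` to `n - l` does not affect
the leading order, and `C * |u| ^ l / l!` is a summable majorant. -/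
theorem tendsto_sum_exp_mul_div_pow (u L C : ℝ) (d : ℕ) (M : ℕ → ℝ)
    (hM : ∀ k n, k ≤ n → n ≠ 0 → |M k| ≤ C * (n : ℝ) ^ d)
    (hL : Tendsto (fun n => M n / (n : ℝ) ^ d) atTop (𝓝 L)) :
    Tendsto (fun n : ℕ => (∑ l ∈ Finset.range (n + 1), u ^ l / l.factorial * M (n - l)) / (n : ℝ) ^ d)
      atTop (𝓝 (Real.exp u * L)) := by
  have hC : 0 ≤ C := by simpa using (abs_nonneg _).trans (hM 0 1 (by norm_num) one_ne_zero)
  have hquot : ∀ l : ℕ, Tendsto (fun n : ℕ => (((n - l : ℕ) : ℝ) / n)) atTop (𝓝 1) := by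
    intro l
    have h1 : Tendsto (fun n : ℕ => 1 - (l : ℝ) / n) atTop (𝓝 (1 - 0)) :=
      tendsto_const_nhds.sub (tendsto_const_div_atTop_nhds_zero_nat (l : ℝ))
    rw [sub_zero] at h1
    refine h1.congr' ?_
    filter_upwards [eventually_ge_atTop l, eventually_gt_atTop 0] with n hn hn0
    have : (n : ℝ) ≠ 0 := Nat.cast_ne_zero.2 hn0.ne'
    rw [Nat.cast_sub hn]
    field_simp
  have hshift : ∀ l : ℕ, Tendsto (fun n : ℕ => M (n - l) / (n : ℝ) ^ d) atTop (𝓝 L) := by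
    intro l
    have h1 := (hL.comp (tendsto_sub_atTop_nat l)).mul ((hquot l).pow d)
    rw [one_pow, mul_one] at h1
    refine h1.congr' ?_
    filter_upwards [eventually_gt_atTop l] with n hn
    have h2 : ((n - l : ℕ) : ℝ) ≠ 0 := Nat.cast_ne_zero.2 (Nat.sub_ne_zero_of_lt hn)
    simp only [Function.comp_apply, div_pow]
    field_simp
  have hexp : Real.exp u * L = ∑' l : ℕ, u ^ l / l.factorial * L := by
    rw [tsum_mul_right, Real.exp_eq_exp_ℝ, NormedSpace.exp_eq_tsum_div]
  have hsum : ∀ n : ℕ, (∑ l ∈ Finset.range (n + 1), u ^ l / l.factorial * M (n - l)) / (n : ℝ) ^ d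
      = ∑' l : ℕ, if l ≤ n then u ^ l / l.factorial * (M (n - l) / (n : ℝ) ^ d) else 0 := by
    intro n
    rw [tsum_eq_sum (s := Finset.range (n + 1))
      (fun l hl => if_neg (by simpa [Nat.lt_succ_iff] using hl)), Finset.sum_div]
    refine Finset.sum_congr rfl fun l hl => ?_
    rw [if_pos (Nat.lt_succ_iff.1 (Finset.mem_range.1 hl)), mul_div_assoc]
  simp only [hsum]
  rw [hexp]
  refine tendsto_tsum_of_dominated_convergence (bound := fun l => |u| ^ l / l.factorial * C)
    ((Real.summable_pow_div_factorial |u|).mul_right C) (fun l => ?_) ?_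
  · refine ((hshift l).const_mul (u ^ l / l.factorial)).congr' ?_
    filter_upwards [eventually_ge_atTop l] with n hn
    rw [if_pos hn]
  · filter_upwards [eventually_gt_atTop 0] with n hn l
    split_ifs
    · rw [Real.norm_eq_abs, abs_mul, abs_div, abs_pow, Nat.abs_cast, abs_div, abs_pow, Nat.abs_cast]
      gcongr
      rw [div_le_iff₀ (by positivity)]
      exact hM _ _ (Nat.sub_le n l) hn.ne'
    · rw [norm_zero]
      positivity

/-- After division by `n!` and `b ^ n`, the expansion over fixed points is an exponential
convolution in `u = (a - m b) / b`. -/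
theorem tendsto_cycleIndex_div (m : ℕ) (hm : m ≠ 0) (a b : ℝ) (hb : b ≠ 0) (L C : ℝ) (d : ℕ)
    (hM : ∀ k n, k ≤ n → n ≠ 0 → |(m.multichoose k : ℝ)| ≤ C * (n : ℝ) ^ d)
    (hL : Tendsto (fun n => (m.multichoose n : ℝ) / (n : ℝ) ^ d) atTop (𝓝 L)) :
    Tendsto (fun n : ℕ => cycleIndex n (fun k => if k = 1 then a else m * b ^ k) / b ^ n
      / (n : ℝ) ^ d) atTop (𝓝 (Real.exp ((a - m * b) / b) * L)) := by
  refine (tendsto_sum_exp_mul_div_pow ((a - m * b) / b) L C d _ hM hL).congr fun n => ?_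
  have hn : (n.factorial : ℝ) ≠ 0 := by positivity
  congr 1
  rw [eq_div_iff (pow_ne_zero n hb), ← mul_right_inj' hn, factorial_mul_cycleIndex n m hm a b,
    colouredSum_diagWeight n m hm a b, Finset.sum_mul, Finset.mul_sum]
  refine Finset.sum_congr rfl fun l hl => ?_
  have hln : l ≤ n := Nat.lt_succ_iff.1 (Finset.mem_range.1 hl)
  rw [Nat.cast_choose ℝ hln]
  have h1 : b ^ n = b ^ (n - l) * b ^ l := by rw [← pow_add, Nat.sub_add_cancel hln]
  have h2 : (l.factorial : ℝ) ≠ 0 := by positivity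
  have h3 : ((n - l).factorial : ℝ) ≠ 0 := by positivity
  rw [h1, div_pow]
  field_simp

theorem cycleIndex_nonneg {n : ℕ} {z : ℕ → ℝ} (hz : ∀ k, 0 ≤ z k) : 0 ≤ cycleIndex n z := by
  refine mul_nonneg (by positivity) (Finset.sum_nonneg fun σ _ => Finset.prod_nonneg fun k _ => ?_)
  exact pow_nonneg (hz k) _

theorem bigPsi_nonneg {n : ℕ} {a b m : ℝ} (ha : 0 ≤ a) (hb : 0 ≤ b) (hm : 0 ≤ m) :
    0 ≤ bigPsi n a b m := by
  refine mul_nonneg (by positivity) (cycleIndex_nonneg fun k => ?_)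
  split_ifs
  · exact ha
  · positivity

theorem tendsto_bigPsi_ratio (a b : ℝ) (hb : 0 < b) :
    Tendsto (fun n : ℕ => bigPsi n a b 3 / bigPsi n a b 2 / n) atTop
      (𝓝 (1 / Real.exp 1 * (1 / 2))) := by
  have hn1 : Tendsto (fun n : ℕ => (1 : ℝ) / n) atTop (𝓝 0) :=
    tendsto_const_div_atTop_nhds_zero_nat 1
  have hc3 : ∀ k : ℕ, ((3 : ℕ).multichoose k : ℝ) = (k + 1) * (k + 2) / 2 := by
    intro k
    rw [Nat.multichoose_eq, show 3 + k - 1 = k + 2 by omega, Nat.choose_symm_add,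
      Nat.cast_choose_two]
    push_cast
    ring
  have hc2 : ∀ k : ℕ, ((2 : ℕ).multichoose k : ℝ) = k + 1 := by
    intro k
    rw [Nat.multichoose_two]
    push_cast
    ring
  have h3 := tendsto_cycleIndex_div 3 (by norm_num) a b hb.ne' (1 / 2) 3 2 (by
      intro k n hkn hn
      have h1 : (1 : ℝ) ≤ n := by exact_mod_cast Nat.one_le_iff_ne_zero.2 hn
      have h2 : (k : ℝ) ≤ n := by exact_mod_cast hkn
      have h0 : (0 : ℝ) ≤ k := by positivity
      rw [hc3, abs_of_nonneg (by positivity)]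
      nlinarith [mul_le_mul h2 h2 h0 (by linarith)]) (by
      have h1 : Tendsto (fun n : ℕ => (1 + (1 : ℝ) / n) * (1 + 2 * ((1 : ℝ) / n)) / 2) atTop
          (𝓝 ((1 + 0) * (1 + 2 * 0) / 2)) :=
        ((hn1.const_add 1).mul ((hn1.const_mul 2).const_add 1)).div_const 2
      rw [show ((1 + 0) * (1 + 2 * 0) / 2 : ℝ) = 1 / 2 by norm_num] at h1
      refine h1.congr' ?_
      filter_upwards [eventually_gt_atTop 0] with n hn
      have : (n : ℝ) ≠ 0 := Nat.cast_ne_zero.2 hn.ne'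
      rw [hc3]
      field_simp)
  have h2 := tendsto_cycleIndex_div 2 (by norm_num) a b hb.ne' 1 2 1 (by
      intro k n hkn hn
      have h1 : (1 : ℝ) ≤ n := by exact_mod_cast Nat.one_le_iff_ne_zero.2 hn
      have h2 : (k : ℝ) ≤ n := by exact_mod_cast hkn
      rw [hc2, abs_of_nonneg (by positivity)]
      linarith) (by
      have h1 := hn1.const_add 1
      rw [add_zero] at h1
      refine h1.congr' ?_
      filter_upwards [eventually_gt_atTop 0] with n hn
      have : (n : ℝ) ≠ 0 := Nat.cast_ne_zero.2 hn.ne'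
      rw [hc2]
      field_simp)
  have h := h3.div h2 (by positivity)
  have hlim : Real.exp ((a - (3 : ℕ) * b) / b) * (1 / 2) / (Real.exp ((a - (2 : ℕ) * b) / b) * 1)
      = 1 / Real.exp 1 * (1 / 2) := by
    -- The exponents for `m = 2` and `m = 3` differ by exactly 1, the source of the factor `1 / e`.
    have : (a - (2 : ℕ) * b) / b = (a - (3 : ℕ) * b) / b + 1 := by
      push_cast
      field_simp
      ring
    rw [this, Real.exp_add]
    field_simp
  rw [hlim] at h
  refine h.congr' ?_
  filter_upwards [eventually_gt_atTop 0] with n hn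
  have hn0 : (n : ℝ) ≠ 0 := Nat.cast_ne_zero.2 hn.ne'
  have hf : (n.factorial : ℝ) ≠ 0 := by positivity
  have hbn : b ^ n ≠ 0 := pow_ne_zero _ hb.ne'
  simp only [Pi.div_apply, bigPsi, Nat.cast_ofNat]
  rw [mul_div_mul_left _ _ (pow_ne_zero 2 hf), div_div_div_comm, div_div_div_cancel_right₀ hbn,
    pow_one, sq, mul_div_cancel_right₀ _ hn0]

/-- Numerator and denominator are both asymptotic to `√(n / (2 e))`; only the leading order of the
closed form is used. -/
theorem tendsto_sqrt_bigPsi_ratio (a b : ℝ) (ha : 0 ≤ a) (hb : 0 < b) :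
    Tendsto (fun n : ℕ =>
      (((bigPsi n a b 3 : ℝ) : ℂ) / ((bigPsi n a b 2 : ℝ) : ℂ)) ^ (1 / 2 : ℂ) /
        ((√((1 / Real.exp 1) *
          ((((n : ℝ) + 2) * ((n : ℝ) + 1) / 2 - (a - 3 * b) * ((n : ℝ) + 1) / b
              + (a - 3 * b) ^ 2 / (2 * b ^ 2)) /
            (((n : ℝ) + 1) - (a - 2 * b) / b))) : ℝ) : ℂ))
      atTop (𝓝 1) := by
  have hn1 : Tendsto (fun n : ℕ => (1 : ℝ) / n) atTop (𝓝 0) :=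
    tendsto_const_div_atTop_nhds_zero_nat 1
  set g : ℕ → ℝ := fun n => (1 / Real.exp 1) *
          ((((n : ℝ) + 2) * ((n : ℝ) + 1) / 2 - (a - 3 * b) * ((n : ℝ) + 1) / b
              + (a - 3 * b) ^ 2 / (2 * b ^ 2)) /
            (((n : ℝ) + 1) - (a - 2 * b) / b)) with hg
  have hgn : Tendsto (fun n => g n / n) atTop (𝓝 (1 / Real.exp 1 * (1 / 2))) := by
    have h1 : Tendsto (fun n : ℕ => (1 / Real.exp 1) *
          (((1 + 2 * ((1 : ℝ) / n)) * (1 + (1 : ℝ) / n) / 2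
            - (a - 3 * b) / b * (1 / n * (1 + (1 : ℝ) / n))
              + (a - 3 * b) ^ 2 / (2 * b ^ 2) * ((1 / n) * (1 / n))) /
            ((1 + (1 : ℝ) / n) - (a - 2 * b) / b * (1 / n)))) atTop
        (𝓝 ((1 / Real.exp 1) *
          (((1 + 2 * (0 : ℝ)) * (1 + 0) / 2 - (a - 3 * b) / b * (0 * (1 + 0))
              + (a - 3 * b) ^ 2 / (2 * b ^ 2) * (0 * 0)) / ((1 + 0) - (a - 2 * b) / b * 0)))) := by
      refine Tendsto.const_mul _ (Tendsto.div (Tendsto.add (Tendsto.sub ?_ ?_) ?_) ?_ (by simp))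
      · exact (((hn1.const_mul 2).const_add 1).mul (hn1.const_add 1)).div_const 2
      · exact (hn1.mul (hn1.const_add 1)).const_mul _
      · exact (hn1.mul hn1).const_mul _
      · exact (hn1.const_add 1).sub (hn1.const_mul _)
    have h2 : ((1 / Real.exp 1) *
          (((1 + 2 * (0 : ℝ)) * (1 + 0) / 2 - (a - 3 * b) / b * (0 * (1 + 0))
              + (a - 3 * b) ^ 2 / (2 * b ^ 2) * (0 * 0)) / ((1 + 0) - (a - 2 * b) / b * 0)))
        = 1 / Real.exp 1 * (1 / 2) := by simp
    rw [h2] at h1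
    refine h1.congr' ?_
    filter_upwards [eventually_gt_atTop 0] with n hn
    have hn0 : (n : ℝ) ≠ 0 := Nat.cast_ne_zero.2 hn.ne'
    rw [hg]
    simp only
    have e1 : (1 + 2 * ((1 : ℝ) / n)) * (1 + (1 : ℝ) / n) / 2
            - (a - 3 * b) / b * (1 / n * (1 + (1 : ℝ) / n))
              + (a - 3 * b) ^ 2 / (2 * b ^ 2) * ((1 / n) * (1 / n))
        = (((n : ℝ) + 2) * ((n : ℝ) + 1) / 2 - (a - 3 * b) * ((n : ℝ) + 1) / b
              + (a - 3 * b) ^ 2 / (2 * b ^ 2)) / (n : ℝ) ^ 2 := by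
      field_simp
    have e2 : (1 + (1 : ℝ) / n) - (a - 2 * b) / b * (1 / n)
        = (((n : ℝ) + 1) - (a - 2 * b) / b) / n := by
      field_simp
    rw [e1, e2, mul_div_assoc (1 / Real.exp 1), div_div_div_comm, sq (n : ℝ), mul_div_cancel_right₀ _ hn0]
  have hc : (0 : ℝ) < 1 / Real.exp 1 * (1 / 2) := by positivity
  have hρ := tendsto_bigPsi_ratio a b hb
  have hq := (hρ.div hgn hc.ne').sqrt
  rw [div_self hc.ne', Real.sqrt_one] at hq
  have hq' := (Complex.continuous_ofReal.tendsto 1).comp hq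
  rw [Complex.ofReal_one] at hq'
  refine hq'.congr' ?_
  filter_upwards [eventually_gt_atTop 0] with n hn
  have hn0 : (n : ℝ) ≠ 0 := Nat.cast_ne_zero.2 hn.ne'
  have h0 : 0 ≤ bigPsi n a b 3 / bigPsi n a b 2 :=
    div_nonneg (bigPsi_nonneg ha hb.le (by norm_num)) (bigPsi_nonneg ha hb.le (by norm_num))
  simp only [Function.comp_apply, Pi.div_apply]
  -- The ratio is a non-negative real, so its principal complex square root is the real one.
  rw [div_div_div_cancel_right₀ hn0, Real.sqrt_div h0, Complex.ofReal_div,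
    Real.sqrt_eq_rpow (bigPsi n a b 3 / _), Complex.ofReal_cpow h0,
    Complex.ofReal_div (bigPsi n a b 3), show (((1 / 2 : ℝ)) : ℂ) = 1 / 2 by norm_num]

/-! ### Partition sums as squared moduli of permanents -/

section PartitionSum

variable {n : ℕ} {W : Type*} [Fintype W]

/-- The factor of a dart in the global function of the ordinary normal factor graph of `θ`. -/
def dartFn (θ : Matrix (Fin n) (Fin n) ℂ) (H : SimpleGraph W) (p : W → Node n)
    (x : H.Dart → Fin 2) (d : H.Dart) : ℂ :=
  match p d.fst, p d.snd with
  | Sum.inl i, Sum.inr j => if x d = x d.symm then (if x d = 1 then θ i j else 1) else 0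
  | _, _ => 1

open Classical in
/-- The global function of the ordinary normal factor graph of `θ`. -/
noncomputable def singleFn (θ : Matrix (Fin n) (Fin n) ℂ) (H : SimpleGraph W) (p : W → Node n)
    (x : H.Dart → Fin 2) : ℂ :=
  (∏ w : W, checkFn (fun d : {d : H.Dart // d.fst = w} => x d.1)) * ∏ d : H.Dart, dartFn θ H p x d

/-- The weight matrix is the rank-one product of the column `(1, t)` and the row `(1, conj t)`, so
the primed and unprimed variables decouple. -/
theorem edgeFn_eq (t : ℂ) (x y : Fin 2 × Fin 2) :
    edgeFn t x y = (if x.1 = y.1 then (if x.1 = 1 then t else 1) else 0) *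
      (if x.2 = y.2 then (if x.2 = 1 then starRingEnd ℂ t else 1) else 0) := by
  obtain ⟨x1, x2⟩ := x
  obtain ⟨y1, y2⟩ := y
  have hn : ((‖t‖ ^ 2 : ℝ) : ℂ) = t * starRingEnd ℂ t := by
    rw [Complex.mul_conj, Complex.normSq_eq_norm_sq]
  simp only [edgeFn, Prod.mk.injEq, weightMatrix, hn]
  fin_cases x1 <;> fin_cases x2 <;> fin_cases y1 <;> fin_cases y2 <;> simp

theorem globalFn_eq (θ : Matrix (Fin n) (Fin n) ℂ) (H : SimpleGraph W) (p : W → Node n)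
    (x : H.Dart → Fin 2 × Fin 2) :
    globalFn θ H p x = singleFn θ H p (fun d => (x d).1) *
      singleFn (θ.map (starRingEnd ℂ)) H p (fun d => (x d).2) := by
  simp only [globalFn, singleFn, deCheckFn, Finset.prod_mul_distrib]
  rw [mul_mul_mul_comm]
  congr 1
  rw [← Finset.prod_mul_distrib]
  refine Finset.prod_congr rfl fun d _ => ?_
  simp only [dartFn]
  rcases p d.fst with i | i <;> rcases p d.snd with j | j <;> simp [edgeFn_eq]

theorem singleFn_conj (θ : Matrix (Fin n) (Fin n) ℂ) (H : SimpleGraph W) (p : W → Node n)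
    (x : H.Dart → Fin 2) :
    singleFn (θ.map (starRingEnd ℂ)) H p x = starRingEnd ℂ (singleFn θ H p x) := by
  simp only [singleFn, map_mul, map_prod]
  congr 1
  · refine Finset.prod_congr rfl fun w _ => ?_
    unfold checkFn
    split_ifs <;> simp
  · refine Finset.prod_congr rfl fun d _ => ?_
    simp only [dartFn]
    rcases p d.fst with i | i <;> rcases p d.snd with j | j <;> simp [apply_ite (starRingEnd ℂ)]

open Classical in
theorem partitionSum_eq_mul_conj (θ : Matrix (Fin n) (Fin n) ℂ) (H : SimpleGraph W)
    (p : W → Node n) :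
    partitionSum θ H p = (∑ x, singleFn θ H p x) * starRingEnd ℂ (∑ x, singleFn θ H p x) := by
  rw [map_sum, Finset.sum_mul_sum, ← Fintype.sum_prod_type', partitionSum,
    ← Equiv.sum_comp (Equiv.arrowProdEquivProdArrow H.Dart (fun _ => Fin 2) fun _ => Fin 2)]
  refine Finset.sum_congr rfl fun x _ => ?_
  rw [globalFn_eq, singleFn_conj]
  rfl

variable {T : Type*} [Fintype T] [DecidableEq T]

open Classical in
/-- The biadjacency matrix of a bipartite graph with entries taken from `θ`. -/
noncomputable def biadjacency (θ : Matrix (Fin n) (Fin n) ℂ) (H : SimpleGraph W)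
    (e : T ⊕ T ≃ W) (q : T → Fin n) (t t' : T) : ℂ :=
  if H.Adj (e (Sum.inl t)) (e (Sum.inr t')) then θ (q t) (q t') else 0

open Classical in
/-- The indicator of the matching `σ` on the darts of a bipartite graph. -/
noncomputable def matchingConfig (H : SimpleGraph W) (e : T ⊕ T ≃ W) (σ : Equiv.Perm T)
    (d : H.Dart) : Fin 2 :=
  if ∃ t, (d.fst = e (Sum.inl t) ∧ d.snd = e (Sum.inr (σ t))) ∨
    (d.snd = e (Sum.inl t) ∧ d.fst = e (Sum.inr (σ t))) then 1 else 0

-- Configurations of nonzero weight are the indicators of perfect matchings, hence correspond to the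
-- permutations all of whose pairs are edges of `H`; the other permutations have a zero biadjacency
-- entry.
open Classical in
theorem sum_singleFn (θ : Matrix (Fin n) (Fin n) ℂ) (H : SimpleGraph W) (p : W → Node n)
    (e : T ⊕ T ≃ W) (q : T → Fin n) (hl : ∀ t, p (e (Sum.inl t)) = Sum.inl (q t))
    (hr : ∀ t, p (e (Sum.inr t)) = Sum.inr (q t))
    (hH : ∀ a b, H.Adj a b → (baseGraph n).Adj (p a) (p b)) :
    ∑ x, singleFn θ H p x = ∑ σ : Equiv.Perm T, ∏ t, biadjacency θ H e q t (σ t) := by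
  have hdart : ∀ d : H.Dart, (∃ t t', d.fst = e (Sum.inl t) ∧ d.snd = e (Sum.inr t')) ∨
      ∃ t t', d.snd = e (Sum.inl t) ∧ d.fst = e (Sum.inr t') := by
    intro d
    have h := hH _ _ d.adj
    obtain ⟨u, hu⟩ := e.surjective d.fst
    obtain ⟨v, hv⟩ := e.surjective d.snd
    rw [← hu, ← hv] at h ⊢
    rcases u with t | t <;> rcases v with t' | t' <;> simp [hl, hr] at h ⊢
  have hdl : ∀ (x : H.Dart → Fin 2) (d : H.Dart) (t t' : T), d.fst = e (Sum.inl t) →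
      d.snd = e (Sum.inr t') → dartFn θ H p x d
        = if x d = x d.symm then (if x d = 1 then θ (q t) (q t') else 1) else 0 := by
    intro x d t t' h1 h2
    simp only [dartFn, h1, h2, hl, hr]
  have hdr : ∀ (x : H.Dart → Fin 2) (d : H.Dart) (t t' : T), d.snd = e (Sum.inl t) →
      d.fst = e (Sum.inr t') → dartFn θ H p x d = 1 := by
    intro x d t t' h1 h2
    simp only [dartFn, h1, h2, hl, hr]
  have hml : ∀ (σ : Equiv.Perm T) (d : H.Dart) (t t' : T), d.fst = e (Sum.inl t) →
      d.snd = e (Sum.inr t') → (matchingConfig H e σ d = 1 ↔ σ t = t') := by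
    intro σ d t t' h1 h2
    simp [matchingConfig, h1, h2, eq_comm]
  have hmr : ∀ (σ : Equiv.Perm T) (d : H.Dart) (t t' : T), d.snd = e (Sum.inl t) →
      d.fst = e (Sum.inr t') → (matchingConfig H e σ d = 1 ↔ σ t = t') := by
    intro σ d t t' h1 h2
    simp [matchingConfig, h1, h2, eq_comm]
  have hsymm : ∀ (σ : Equiv.Perm T) (d : H.Dart),
      matchingConfig H e σ d = matchingConfig H e σ d.symm := by
    intro σ d
    simp only [matchingConfig, SimpleGraph.Dart.symm_toProd, Prod.fst_swap, Prod.snd_swap]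
    congr 1
    simp only [or_comm]
  symm
  rw [← Finset.sum_filter_of_ne
    (p := fun σ : Equiv.Perm T => ∀ t, H.Adj (e (Sum.inl t)) (e (Sum.inr (σ t))))]
  swap
  · intro σ _ hσ t
    by_contra h
    exact hσ (Finset.prod_eq_zero (Finset.mem_univ t) (if_neg h))
  refine Finset.sum_of_injOn (matchingConfig H e) ?_ (fun _ _ => Finset.mem_coe.2 (Finset.mem_univ _)) ?_ ?_
  · intro σ hσ τ _ hστ
    have hσ' : ∀ t, H.Adj (e (Sum.inl t)) (e (Sum.inr (σ t))) := by simpa using hσ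
    ext t
    have h1 := (hml σ ⟨(_, _), hσ' t⟩ t (σ t) rfl rfl).2 rfl
    rw [hστ, hml τ _ t (σ t) rfl rfl] at h1
    exact h1.symm
  · intro x _ hx
    by_contra hne
    refine hx ?_
    -- Nonzero weight forces every check and edge factor to be nonzero: one active dart at each
    -- vertex, and equal values on a dart and its reverse. The active darts leaving left vertices
    -- define `f`; uniqueness at right vertices makes it injective.
    have hcheck : ∀ w, ∃! d : {d : H.Dart // d.fst = w}, x d.1 = 1 := by
      intro w
      by_contra h
      exact hne (mul_eq_zero_of_left (Finset.prod_eq_zero (Finset.mem_univ w) (if_neg h)) _)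
    have hdart_ne : ∀ d, dartFn θ H p x d ≠ 0 := fun d h =>
      hne (mul_eq_zero_of_right _ (Finset.prod_eq_zero (Finset.mem_univ d) h))
    have hx_symm : ∀ d : H.Dart, x d = x d.symm := by
      have h1 : ∀ (d : H.Dart) (t t' : T), d.fst = e (Sum.inl t) →
          d.snd = e (Sum.inr t') → x d = x d.symm := by
        intro d t t' h1 h2
        by_contra h
        exact hdart_ne d (by rw [hdl x d t t' h1 h2, if_neg h])
      intro d
      rcases hdart d with ⟨t, t', h2, h3⟩ | ⟨t, t', h2, h3⟩
      · exact h1 d t t' h2 h3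
      · have := h1 d.symm t t' h2 h3
        rw [SimpleGraph.Dart.symm_symm] at this
        exact this.symm
    have hex : ∀ t, ∃ t', ∃ h : H.Adj (e (Sum.inl t)) (e (Sum.inr t')), x ⟨(_, _), h⟩ = 1 := by
      intro t
      obtain ⟨⟨⟨⟨u, v⟩, huv⟩, rfl : u = _⟩, hd, -⟩ := hcheck (e (Sum.inl t))
      rcases hdart ⟨(_, v), huv⟩ with ⟨s, t', h2, rfl : v = _⟩ | ⟨s, t', h2, h3⟩
      · exact ⟨t', huv, hd⟩
      · exact absurd (e.injective h3) (by simp)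
    choose f hf hf1 using hex
    have huniq : ∀ (w : W) (d d' : H.Dart), d.fst = w → d'.fst = w → x d = 1 → x d' = 1 → d = d' := by
      intro w d d' h1 h2 h3 h4
      exact congrArg Subtype.val ((hcheck w).unique (y₁ := ⟨d, h1⟩) (y₂ := ⟨d', h2⟩) h3 h4)
    have hinj : Function.Injective f := by
      intro t t' htt
      have h1 := huniq (e (Sum.inr (f t))) (SimpleGraph.Dart.symm ⟨(_, _), hf t⟩)
        (SimpleGraph.Dart.symm ⟨(_, _), hf t'⟩) rfl (congrArg (fun s => e (Sum.inr s)) htt.symm)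
        (by rw [← hx_symm, hf1]) (by rw [← hx_symm, hf1])
      have h2 : e (Sum.inl t) = e (Sum.inl t') := congrArg (fun d : H.Dart => d.snd) h1
      simpa using h2
    let σ : Equiv.Perm T := Equiv.ofBijective f (Finite.injective_iff_bijective.1 hinj)
    have hfσ : ∀ t, H.Adj (e (Sum.inl t)) (e (Sum.inr (σ t))) := hf
    refine ⟨σ, by simpa using hfσ, ?_⟩
    have hmain : ∀ (d : H.Dart) (t t' : T), d.fst = e (Sum.inl t) →
          d.snd = e (Sum.inr t') → matchingConfig H e σ d = x d := by
      intro d t t' h1 h2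
      have h3 : matchingConfig H e σ d = 1 ↔ x d = 1 := by
        rw [hml σ d t t' h1 h2]
        constructor
        · rintro rfl
          rw [← hf1 t]
          exact congrArg x <| SimpleGraph.Dart.ext _ _ (Prod.ext h1 h2)
        · intro h
          have h4 := huniq _ d ⟨(_, _), hf t⟩ h1 rfl h (hf1 t)
          have h5 : d.snd = e (Sum.inr (f t)) := by rw [h4]
          have h6 : f t = t' := by simpa [h2] using h5.symm
          exact h6
      by_cases hxd : x d = 1
      · rw [hxd, h3.2 hxd]
      · have h4 : ∀ k : Fin 2, k ≠ 1 → k = 0 := by decide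
        rw [h4 _ hxd, h4 _ (mt h3.1 hxd)]
    funext d
    rcases hdart d with ⟨t, t', h2, h3⟩ | ⟨t, t', h2, h3⟩
    · exact hmain d t t' h2 h3
    · rw [hsymm, hx_symm]
      exact hmain d.symm t t' h2 h3
  · intro σ hσ
    have hσ' : ∀ t, H.Adj (e (Sum.inl t)) (e (Sum.inr (σ t))) := by simpa using hσ
    suffices h1 : (∏ w : W, checkFn (fun d : {d : H.Dart // d.fst = w} =>
        matchingConfig H e σ d.1)) = 1 ∧ ∏ t, biadjacency θ H e q t (σ t)
          = ∏ d : H.Dart, dartFn θ H p (matchingConfig H e σ) d by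
      rw [singleFn, h1.1, h1.2, one_mul]
    refine ⟨Finset.prod_eq_one fun w _ => ?_, ?_⟩
    rotate_left
    · refine Finset.prod_of_injOn (fun t => (⟨(_, _), hσ' t⟩ : H.Dart)) ?_
        (fun _ _ => Finset.mem_coe.2 (Finset.mem_univ _)) ?_ ?_
      · intro t _ t' _ h
        have h2 : e (Sum.inl t) = e (Sum.inl t') := congrArg (fun d : H.Dart => d.fst) h
        simpa using h2
      · intro d _ hd
        rcases hdart d with ⟨t, t', h2, h3⟩ | ⟨t, t', h2, h3⟩
        · rw [hdl _ d t t' h2 h3, if_pos (hsymm σ d), if_neg]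
          rw [hml σ d t t' h2 h3]
          rintro rfl
          exact hd ⟨t, Finset.mem_coe.2 (Finset.mem_univ _),
            SimpleGraph.Dart.ext _ _ (Prod.ext h2.symm h3.symm)⟩
        · exact hdr _ d t t' h2 h3
      · intro t _
        rw [hdl _ _ t (σ t) rfl rfl, if_pos (hsymm σ _), if_pos ((hml σ _ t _ rfl rfl).2 rfl),
          biadjacency, if_pos (hσ' t)]
    · refine if_pos ?_
      obtain ⟨u, rfl⟩ := e.surjective w
      rcases u with t | t
      · refine ⟨⟨⟨(_, _), hσ' t⟩, rfl⟩, (hml σ _ t _ rfl rfl).2 rfl, ?_⟩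
        rintro ⟨d, hd⟩ h
        refine Subtype.ext (SimpleGraph.Dart.ext _ _ ?_)
        rcases hdart d with ⟨s, t', h2, h3⟩ | ⟨s, t', h2, h3⟩
        · rw [hml σ d s t' h2 h3] at h
          have hs : t = s := by simpa using hd.symm.trans h2
          subst hs
          exact Prod.ext h2 (h3.trans (congrArg (fun r => e (Sum.inr r)) h.symm))
        · exact absurd (hd.symm.trans h3) (by simp)
      · have hadj : H.Adj (e (Sum.inl (σ.symm t))) (e (Sum.inr t)) := by
          simpa using hσ' (σ.symm t)
        refine ⟨⟨⟨(_, _), hadj.symm⟩, rfl⟩, (hmr σ _ (σ.symm t) t rfl rfl).2 (by simp), ?_⟩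
        rintro ⟨d, hd⟩ h
        refine Subtype.ext (SimpleGraph.Dart.ext _ _ ?_)
        rcases hdart d with ⟨s, t', h2, h3⟩ | ⟨s, t', h2, h3⟩
        · exact absurd (hd.symm.trans h2) (by simp)
        · rw [hmr σ d s t' h2 h3] at h
          have hs : t = t' := by simpa using hd.symm.trans h3
          subst hs
          have hs : s = σ.symm t := by simp [← h]
          exact Prod.ext h3 (h2.trans (congrArg (fun r => e (Sum.inl r)) hs))

/-- The partition sum of a double-edge normal factor graph on a bipartite graph is the squared
modulus of the permanent of its biadjacency matrix. -/
theorem partitionSum_eq (θ : Matrix (Fin n) (Fin n) ℂ) (H : SimpleGraph W) (p : W → Node n)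
    (e : T ⊕ T ≃ W) (q : T → Fin n) (hl : ∀ t, p (e (Sum.inl t)) = Sum.inl (q t))
    (hr : ∀ t, p (e (Sum.inr t)) = Sum.inr (q t))
    (hH : ∀ a b, H.Adj a b → (baseGraph n).Adj (p a) (p b)) :
    partitionSum θ H p = (∑ σ : Equiv.Perm T, ∏ t, biadjacency θ H e q t (σ t)) *
      starRingEnd ℂ (∑ σ : Equiv.Perm T, ∏ t, biadjacency θ H e q t (σ t)) := by
  rw [partitionSum_eq_mul_conj, sum_singleFn θ H p e q hl hr hH]

end PartitionSum

theorem Z_eq {n : ℕ} (θ : Matrix (Fin n) (Fin n) ℂ) :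
    Z θ = (∑ σ : Equiv.Perm (Fin n), ∏ i, θ i (σ i)) *
      starRingEnd ℂ (∑ σ : Equiv.Perm (Fin n), ∏ i, θ i (σ i)) := by
  rw [Z, partitionSum_eq θ (baseGraph n) id (Equiv.refl _) id (fun _ => rfl) (fun _ => rfl)
    fun _ _ => id]
  simp [biadjacency]

/-! ### Two-covers of the complete bipartite graph -/

/-- The adjacency relation of the 2-cover in which the edge above `(i, j)` is crossed if and only if
`s i j = 1`. -/
def coverAdj {n : ℕ} (s : Fin n → Fin n → Fin 2) : Node n × Fin 2 → Node n × Fin 2 → Prop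
  | (Sum.inl i, k), (Sum.inr j, l) => l = k + s i j
  | (Sum.inr j, l), (Sum.inl i, k) => l = k + s i j
  | _, _ => False

/-- The 2-cover in which the edge above `(i, j)` is crossed if and only if `s i j = 1`. -/
def coverGraph {n : ℕ} (s : Fin n → Fin n → Fin 2) : SimpleGraph (Node n × Fin 2) where
  Adj := coverAdj s
  symm := ⟨by
    rintro ⟨i | i, k⟩ ⟨j | j, l⟩ h
    · exact h
    · exact h
    · exact h
    · exact h⟩
  loopless := ⟨by
    rintro ⟨i | i, k⟩ h
    · exact h
    · exact h⟩

theorem isCover_coverGraph {n : ℕ} (s : Fin n → Fin n → Fin 2) :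
    IsCover (baseGraph n) (coverGraph s) Prod.fst := by
  have h2 : ∀ l k : Fin 2, l + k + k = l := by decide
  refine ⟨?_, ?_⟩
  · rintro ⟨i | i, k⟩ ⟨j | j, l⟩ h
    · exact absurd h id
    · simp
    · simp
    · exact absurd h id
  · rintro ⟨i | i, k⟩
    · refine ⟨?_, ?_, ?_⟩
      · rintro ⟨j | j, l⟩ h
        · exact absurd h id
        · simp
      · rintro ⟨j | j, l⟩ h ⟨j' | j', l'⟩ h' hj
        · exact absurd h id
        · exact absurd h id
        · exact absurd h' id
        · have hj' : j = j' := by simpa using hj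
          subst hj'
          have e1 : l = k + s i j := h
          have e2 : l' = k + s i j := h'
          rw [e1, e2]
      · rintro (j | j) h
        · simp at h
        · exact ⟨(Sum.inr j, k + s i j), rfl, rfl⟩
    · refine ⟨?_, ?_, ?_⟩
      · rintro ⟨j | j, l⟩ h
        · simp
        · exact absurd h id
      · rintro ⟨j | j, l⟩ h ⟨j' | j', l'⟩ h' hj
        · have hj' : j = j' := by simpa using hj
          subst hj'
          have e1 : k = l + s j i := h
          have e2 : k = l' + s j i := h'
          rw [e1] at e2
          rw [add_right_cancel e2]
        · exact absurd h' id
        · exact absurd h id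
        · exact absurd h id
      · rintro (j | j) h
        · exact ⟨(Sum.inl j, k + s j i), (h2 _ _).symm, rfl⟩
        · simp at h

theorem exists_coverGraph_eq {n : ℕ} (H : SimpleGraph (Node n × Fin 2))
    (hH : IsCover (baseGraph n) H Prod.fst) : ∃ s, coverGraph s = H := by
  obtain ⟨hhom, hbij⟩ := hH
  have hex : ∀ i j k, ∃ l, H.Adj (Sum.inl i, k) (Sum.inr j, l) := by
    intro i j k
    obtain ⟨⟨v, l⟩, hv, hvj⟩ := (hbij (Sum.inl i, k)).surjOn
      (show (Sum.inr j : Node n) ∈ (baseGraph n).neighborSet (Sum.inl i) by simp)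
    have hvj' : v = Sum.inr j := hvj
    subst hvj'
    exact ⟨l, hv⟩
  choose f hf using hex
  have huniq : ∀ i j k l, H.Adj (Sum.inl i, k) (Sum.inr j, l) → l = f i j k := by
    intro i j k l h
    have := (hbij (Sum.inl i, k)).injOn h (hf i j k) rfl
    simpa using this
  -- Otherwise a right vertex would have two neighbours above the same `i`. So the edges above `(i,
  -- j)` form a permutation of `Fin 2`, that is, the translation by `f i j 0`.
  have hne : ∀ i j, f i j 1 ≠ f i j 0 := by
    intro i j h
    have h1 := (hf i j 1).symm
    rw [h] at h1
    have := (hbij (Sum.inr j, f i j 0)).injOn h1 (hf i j 0).symm rfl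
    simp at this
  have hval : ∀ i j k, f i j k = k + f i j 0 := by
    intro i j k
    have h2 : ∀ u v : Fin 2, u ≠ v → u = 1 + v := by decide
    fin_cases k
    · exact (zero_add _).symm
    · exact h2 _ _ (hne i j)
  have hadj : ∀ i j k l, H.Adj (Sum.inl i, k) (Sum.inr j, l) ↔ l = k + f i j 0 := by
    intro i j k l
    rw [← hval]
    refine ⟨huniq i j k l, ?_⟩
    rintro rfl
    exact hf i j k
  refine ⟨fun i j => f i j 0, ?_⟩
  ext ⟨i | i, k⟩ ⟨j | j, l⟩
  · exact ⟨fun h => absurd h id, fun h => by simpa using hhom _ _ h⟩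
  · exact (hadj i j k l).symm
  · rw [H.adj_comm]
    exact (hadj j i l k).symm
  · exact ⟨fun h => absurd h id, fun h => by simpa using hhom _ _ h⟩

theorem coverGraph_injective (n : ℕ) :
    Function.Injective (coverGraph : (Fin n → Fin n → Fin 2) → _) := by
  intro s s' h
  funext i j
  have h1 : (coverGraph s).Adj (Sum.inl i, 0) (Sum.inr j, 0 + s i j) := rfl
  rw [h] at h1
  have h2 : 0 + s i j = 0 + s' i j := h1
  simpa using h2

/-- The 2-covers of the complete bipartite graph are parametrized by the crossed edges. -/
noncomputable def coverEquiv (n : ℕ) : (Fin n → Fin n → Fin 2) ≃ MCover (baseGraph n) 2 :=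
  Equiv.ofBijective (fun s => ⟨coverGraph s, isCover_coverGraph s⟩)
    ⟨fun _ _ h => coverGraph_injective n (congrArg Subtype.val h), fun H => by
      obtain ⟨s, hs⟩ := exists_coverGraph_eq H.1 H.2
      exact ⟨s, Subtype.ext hs⟩⟩

/-- The matrix obtained from `θ` by replacing its entries by 2×2 blocks supported on a permutation
matrix. -/
def liftMatrix {R : Type*} [Zero R] {n : ℕ} (θ : Matrix (Fin n) (Fin n) R)
    (s : Fin n → Fin n → Fin 2) (t t' : Fin n × Fin 2) : R :=
  if t'.2 = t.2 + s t.1 t'.1 then θ t.1 t'.1 else 0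

theorem partitionSum_coverGraph {n : ℕ} (θ : Matrix (Fin n) (Fin n) ℂ)
    (s : Fin n → Fin n → Fin 2) :
    partitionSum θ (coverGraph s) Prod.fst =
      (∑ σ : Equiv.Perm (Fin n × Fin 2), ∏ t, liftMatrix θ s t (σ t)) *
        starRingEnd ℂ (∑ σ : Equiv.Perm (Fin n × Fin 2), ∏ t, liftMatrix θ s t (σ t)) := by
  rw [partitionSum_eq θ (coverGraph s) Prod.fst (Equiv.sumProdDistrib _ _ _).symm Prod.fst
    (fun _ => rfl) (fun _ => rfl) (isCover_coverGraph s).1]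
  have h : biadjacency θ (coverGraph s) (Equiv.sumProdDistrib _ _ _).symm Prod.fst
      = liftMatrix θ s := by
    funext t t'
    unfold biadjacency liftMatrix
    congr 1
  rw [h]

theorem bethe_two_sq {n : ℕ} (θ : Matrix (Fin n) (Fin n) ℂ) :
    bethe 2 θ ^ 2 = (2 ^ (n * n) : ℂ)⁻¹ * ∑ s : Fin n → Fin n → Fin 2,
      (∑ σ : Equiv.Perm (Fin n × Fin 2), ∏ t, liftMatrix θ s t (σ t)) *
        starRingEnd ℂ (∑ σ : Equiv.Perm (Fin n × Fin 2), ∏ t, liftMatrix θ s t (σ t)) := by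
  classical
  have h1 : (Fintype.card (MCover (baseGraph n) 2) : ℂ) = 2 ^ (n * n) := by
    rw [← Fintype.card_congr (coverEquiv n)]
    simp [← pow_mul]
  have h2 : ∑ H : MCover (baseGraph n) 2, partitionSum θ H.1 Prod.fst
      = ∑ s, partitionSum θ (coverGraph s) Prod.fst :=
    (Equiv.sum_comp (coverEquiv n) _).symm
  simp only [← partitionSum_coverGraph]
  rw [← h1, ← h2, ← div_eq_inv_mul]
  -- Squaring undoes the principal square root, whatever the value of the average.
  exact Complex.cpow_nat_inv_pow _ two_ne_zero

/-! ### Moments of products of matrix entries -/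

theorem integrable_pow_mul_conj {D : Measure ℂ} [IsProbabilityMeasure D]
    (h : Integrable (fun z : ℂ => ‖z‖ ^ 4) D) {p q : ℕ} (hpq : p + q ≤ 4) :
    Integrable (fun z : ℂ => z ^ p * starRingEnd ℂ (z ^ q)) D := by
  refine ((integrable_const (1 : ℝ)).add h).mono' (by fun_prop) (ae_of_all _ fun z => ?_)
  rw [norm_mul, RCLike.norm_conj, norm_pow, norm_pow, ← pow_add]
  simp only [Pi.add_apply]
  rcases le_total ‖z‖ 1 with hz | hz
  · have := pow_le_one₀ (n := p + q) (norm_nonneg z) hz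
    have := pow_nonneg (norm_nonneg z) 4
    linarith
  · have := pow_le_pow_right₀ hz hpq
    linarith

section Entries

variable {Ω : Type*} [MeasurableSpace Ω] {P : Measure Ω} [IsProbabilityMeasure P] {D : Measure ℂ}
  [IsProbabilityMeasure D] {n : ℕ} {θ : Ω → Matrix (Fin n) (Fin n) ℂ}

theorem integral_prod_entries (h_law : ∀ i j, HasLaw (fun ω => θ ω i j) D P)
    (h_indep : iIndepFun (fun (ij : Fin n × Fin n) (ω : Ω) => θ ω ij.1 ij.2) P)
    (g : Fin n × Fin n → ℂ → ℂ) (hg : ∀ ij, Integrable (g ij) D) :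
    Integrable (fun ω => ∏ ij : Fin n × Fin n, g ij (θ ω ij.1 ij.2)) P ∧
      ∫ ω, ∏ ij : Fin n × Fin n, g ij (θ ω ij.1 ij.2) ∂P = ∏ ij, ∫ z, g ij z ∂D := by
  have hae : ∀ ij : Fin n × Fin n, AEMeasurable (fun ω => θ ω ij.1 ij.2) P :=
    fun ij => (h_law ij.1 ij.2).aemeasurable
  have hmap : P.map (fun ω (ij : Fin n × Fin n) => θ ω ij.1 ij.2) = Measure.pi fun _ => D := by
    rw [(iIndepFun_iff_map_fun_eq_pi_map hae).1 h_indep]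
    exact congrArg Measure.pi (funext fun ij => (h_law ij.1 ij.2).map_eq)
  have hae' : AEMeasurable (fun ω (ij : Fin n × Fin n) => θ ω ij.1 ij.2) P := aemeasurable_pi_lambda _ hae
  have hint := Integrable.fintype_prod (f := g) hg
  rw [← hmap] at hint
  refine ⟨hint.comp_aemeasurable hae', ?_⟩
  rw [← integral_fintype_prod_eq_prod, ← hmap, integral_map hae' hint.aestronglyMeasurable]

/-- The product of two entries and two conjugated entries of a row. -/
noncomputable def rowProd (r : Fin n → ℂ) (J : Fin n × Fin n × Fin n × Fin n) : ℂ :=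
  r J.1 * r J.2.1 * (starRingEnd ℂ (r J.2.2.1) * starRingEnd ℂ (r J.2.2.2))

theorem rowProd_eq_prod (r : Fin n → ℂ) (J : Fin n × Fin n × Fin n × Fin n) :
    rowProd r J = ∏ j, r j ^ ((if J.1 = j then 1 else 0) + if J.2.1 = j then 1 else 0) *
      starRingEnd ℂ (r j ^ ((if J.2.2.1 = j then 1 else 0) + if J.2.2.2 = j then 1 else 0)) := by
  have h1 : ∀ (c : Fin n) (u : Fin n → ℂ), ∏ j, u j ^ (if c = j then 1 else 0) = u c := by
    intro c u
    simp [pow_ite]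
  simp only [pow_add, map_mul, map_pow, Finset.prod_mul_distrib]
  rw [h1 J.1 r, h1 J.2.1 r, h1 J.2.2.1 fun j => starRingEnd ℂ (r j),
    h1 J.2.2.2 fun j => starRingEnd ℂ (r j), rowProd]

/-- Column `j` contributes the moment given by its multiplicities in `j₀, j₁` and in `j₂, j₃`.
Outside the surviving patterns some column occurs exactly once and contributes `μ 1 0` or `μ 0 1`,
which vanish; third moments therefore never matter. -/
theorem prod_moments_eq_pairing {R : Type*} [CommRing R] (μ : ℕ → ℕ → R) (a b : R)
    (h00 : μ 0 0 = 1) (h10 : μ 1 0 = 0) (h01 : μ 0 1 = 0) (h22 : μ 2 2 = a)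
    (h20 : μ 2 0 * μ 0 2 = b) (h11 : μ 1 1 * μ 1 1 = b) (j₀ j₁ j₂ j₃ : Fin n) :
    ∏ j, μ ((if j₀ = j then 1 else 0) + if j₁ = j then 1 else 0)
      ((if j₂ = j then 1 else 0) + if j₃ = j then 1 else 0) = pairing a b j₀ j₁ j₂ j₃ := by
  unfold pairing
  by_cases h1 : j₁ = j₀
  · subst h1
    rw [if_pos rfl]
    by_cases h3 : j₃ = j₂
    · subst h3
      rw [if_pos rfl]
      by_cases h2 : j₃ = j₁
      · subst h2
        rw [if_pos rfl, Finset.prod_eq_single j₃ (by intro j _ hj; simp [hj.symm, h00]) (by simp)]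
        simp [h22]
      · rw [if_neg h2, Finset.prod_eq_mul j₁ j₃ (Ne.symm h2)
          (by intro j _ hj; simp [hj.1.symm, hj.2.symm, h00]) (by simp) (by simp)]
        simp [h2, Ne.symm h2, h20]
    · rw [if_neg h3]
      by_cases h2 : j₂ = j₁
      · subst h2
        exact Finset.prod_eq_zero (Finset.mem_univ j₃) (by simp [Ne.symm h3, h01])
      · exact Finset.prod_eq_zero (Finset.mem_univ j₂) (by simp [Ne.symm h2, h3, h01])
  · rw [if_neg h1]
    by_cases h2 : j₂ = j₀
    · subst h2
      by_cases h3 : j₃ = j₁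
      · subst h3
        rw [if_pos (Or.inl ⟨rfl, rfl⟩), Finset.prod_eq_mul j₂ j₃ (Ne.symm h1)
          (by intro j _ hj; simp [hj.1.symm, hj.2.symm, h00]) (by simp) (by simp)]
        simp [h1, Ne.symm h1, h11]
      · rw [if_neg (by simp [h3, Ne.symm h1])]
        exact Finset.prod_eq_zero (Finset.mem_univ j₁) (by simp [Ne.symm h1, h3, h10])
    · by_cases h3 : j₃ = j₀
      · subst h3
        by_cases h4 : j₂ = j₁
        · subst h4
          rw [if_pos (Or.inr ⟨rfl, rfl⟩), Finset.prod_eq_mul j₃ j₂ (Ne.symm h1)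
            (by intro j _ hj; simp [hj.1.symm, hj.2.symm, h00]) (by simp) (by simp)]
          simp [h1, Ne.symm h1, h11]
        · rw [if_neg (by simp [h2, h4])]
          exact Finset.prod_eq_zero (Finset.mem_univ j₁) (by simp [Ne.symm h1, h4, h10])
      · rw [if_neg (by simp [h2, h3])]
        exact Finset.prod_eq_zero (Finset.mem_univ j₀) (by simp [h1, h2, h3, h10])

theorem integral_prod_rowProd (h_fourth : Integrable (fun z : ℂ => ‖z‖ ^ 4) D)
    (h_law : ∀ i j, HasLaw (fun ω => θ ω i j) D P)
    (h_indep : iIndepFun (fun (ij : Fin n × Fin n) (ω : Ω) => θ ω ij.1 ij.2) P) (a b : ℂ)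
    (h10 : moment D 1 0 = 0) (h01 : moment D 0 1 = 0) (h22 : moment D 2 2 = a)
    (h20 : moment D 2 0 * moment D 0 2 = b) (h11 : moment D 1 1 * moment D 1 1 = b)
    (F : Fin n → Fin n × Fin n × Fin n × Fin n) :
    Integrable (fun ω => ∏ i, rowProd (θ ω i) (F i)) P ∧
      ∫ ω, ∏ i, rowProd (θ ω i) (F i) ∂P
        = ∏ i, pairing a b (F i).1 (F i).2.1 (F i).2.2.1 (F i).2.2.2 := by
  have key := integral_prod_entries h_law h_indep
    (fun ij z => z ^ ((if (F ij.1).1 = ij.2 then 1 else 0) + if (F ij.1).2.1 = ij.2 then 1 else 0) *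
      starRingEnd ℂ (z ^ ((if (F ij.1).2.2.1 = ij.2 then 1 else 0) +
        if (F ij.1).2.2.2 = ij.2 then 1 else 0)))
    (fun ij => integrable_pow_mul_conj h_fourth (by split_ifs <;> norm_num))
  simp only [Fintype.prod_prod_type] at key
  simp only [rowProd_eq_prod]
  refine ⟨key.1, key.2.trans (Finset.prod_congr rfl fun i _ => ?_)⟩
  exact prod_moments_eq_pairing (moment D) a b (by simp [moment]) h10 h01 h22 h20 h11 _ _ _ _

/-- Expanded over a choice of indices in each row, the expression is a finite combination of
products over rows. Independence thus replaces each `rowProd` by its mean, and the result refactors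
over rows. -/
theorem integral_row_polynomials {B : Type*} [CommRing B] [Algebra ℂ B] (Λ : B →ₗ[ℂ] ℂ)
    (h_fourth : Integrable (fun z : ℂ => ‖z‖ ^ 4) D)
    (h_law : ∀ i j, HasLaw (fun ω => θ ω i j) D P)
    (h_indep : iIndepFun (fun (ij : Fin n × Fin n) (ω : Ω) => θ ω ij.1 ij.2) P) (a b : ℂ)
    (h10 : moment D 1 0 = 0) (h01 : moment D 0 1 = 0) (h22 : moment D 2 2 = a)
    (h20 : moment D 2 0 * moment D 0 2 = b) (h11 : moment D 1 1 * moment D 1 1 = b)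
    (z : Fin n → Fin n × Fin n × Fin n × Fin n → B) :
    Integrable (fun ω => Λ (∏ i, ∑ J, rowProd (θ ω i) J • z i J)) P ∧
      ∫ ω, Λ (∏ i, ∑ J, rowProd (θ ω i) J • z i J) ∂P
        = Λ (∏ i, ∑ J, pairing a b J.1 J.2.1 J.2.2.1 J.2.2.2 • z i J) := by
  have key := integral_prod_rowProd h_fourth h_law h_indep a b h10 h01 h22 h20 h11
  have h1 : ∀ ω, Λ (∏ i, ∑ J, rowProd (θ ω i) J • z i J)
      = ∑ F : Fin n → Fin n × Fin n × Fin n × Fin n,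
        (∏ i, rowProd (θ ω i) (F i)) * Λ (∏ i, z i (F i)) := by
    intro ω
    rw [prod_sum_smul (fun i J => rowProd (θ ω i) J) z, map_sum]
    simp only [map_smul, smul_eq_mul]
  simp only [h1]
  refine ⟨integrable_finsetSum _ fun F _ => (key F).1.mul_const _, ?_⟩
  rw [integral_finsetSum _ fun F _ => (key F).1.mul_const _,
    prod_sum_smul (fun _ J => pairing a b J.1 J.2.1 J.2.2.1 J.2.2.2) z, map_sum]
  refine Finset.sum_congr rfl fun F _ => ?_
  rw [integral_mul_const, (key F).2, map_smul, smul_eq_mul]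

end Entries

theorem prod_four_sums_smul {B : Type*} [CommRing B] [Algebra ℂ B] {n : ℕ} (r : Fin n → ℂ)
    (y₀ y₁ y₂ y₃ : Fin n → B) :
    (∑ j, r j • y₀ j) * (∑ j, r j • y₁ j) *
      ((∑ j, starRingEnd ℂ (r j) • y₂ j) * (∑ j, starRingEnd ℂ (r j) • y₃ j))
      = ∑ J : Fin n × Fin n × Fin n × Fin n,
        rowProd r J • (y₀ J.1 * y₁ J.2.1 * (y₂ J.2.2.1 * y₃ J.2.2.2)) := by
  simp only [Fintype.sum_prod_type, Finset.sum_mul_sum, rowProd, smul_mul_smul_comm]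
  exact Finset.sum_congr rfl fun j _ => Finset.sum_comm

/-- `Z ^ 2` is a product of four permanents, two of them conjugated. Each gets its own set of
variables, and the factors are regrouped by rows. -/
theorem Z_sq_eq {B : Type*} [CommRing B] [Algebra ℂ B] {n : ℕ} (y : Fin n × Fin 4 → B)
    (hy : ∀ i, y i * y i = 0) (Λ : B →ₗ[ℂ] ℂ) (hΛ : Λ (∏ i, y i) = 1)
    (θ : Matrix (Fin n) (Fin n) ℂ) :
    Z θ ^ 2 = Λ (∏ i, ∑ J : Fin n × Fin n × Fin n × Fin n, rowProd (θ i) J •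
      (y (J.1, 0) * y (J.2.1, 1) * (y (J.2.2.1, 2) * y (J.2.2.2, 3)))) := by
  have h1 : ∀ t, ∏ i, ∑ j, θ i j • y (j, t)
      = (∑ σ : Equiv.Perm (Fin n), ∏ i, θ i (σ i)) • ∏ j, y (j, t) := fun t =>
    prod_sum_smul_eq_permanent θ (fun j => y (j, t)) fun j => hy _
  have h2 : ∀ t, ∏ i, ∑ j, starRingEnd ℂ (θ i j) • y (j, t)
      = starRingEnd ℂ (∑ σ : Equiv.Perm (Fin n), ∏ i, θ i (σ i)) • ∏ j, y (j, t) := by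
    intro t
    rw [prod_sum_smul_eq_permanent (fun i j => starRingEnd ℂ (θ i j)) (fun j => y (j, t))
      fun j => hy _]
    simp only [map_sum, map_prod]
  have hF : ∏ i, y i = (∏ j, y (j, 0)) * (∏ j, y (j, 1)) * ((∏ j, y (j, 2)) * ∏ j, y (j, 3)) := by
    rw [Fintype.prod_prod_type]
    simp [Fin.prod_univ_four, Finset.prod_mul_distrib, mul_assoc]
  have h3 : ∀ i, ∑ J : Fin n × Fin n × Fin n × Fin n, rowProd (θ i) J •
      (y (J.1, 0) * y (J.2.1, 1) * (y (J.2.2.1, 2) * y (J.2.2.2, 3)))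
      = _ := fun i => (prod_four_sums_smul (θ i) (fun j => y (j, 0)) (fun j => y (j, 1))
        (fun j => y (j, 2)) (fun j => y (j, 3))).symm
  simp only [h3, Finset.prod_mul_distrib, h1, h2, smul_mul_smul_comm]
  rw [← hF, map_smul, hΛ, smul_eq_mul, mul_one, Z_eq]
  ring

theorem sum_liftMatrix_smul {R B : Type*} [CommRing R] [CommRing B] [Algebra R B] {n : ℕ}
    (θ : Matrix (Fin n) (Fin n) R) (s : Fin n → Fin n → Fin 2) (y : Fin n × Fin 2 → B)
    (t : Fin n × Fin 2) :
    ∑ t', liftMatrix θ s t t' • y t' = ∑ j, θ t.1 j • y (j, t.2 + s t.1 j) := by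
  simp [Fintype.sum_prod_type, liftMatrix, ite_smul]

/-- Here the four linear forms of row `i` come from the two lifted rows `(i, 0)` and `(i, 1)` and
their conjugates; they involve only the bits `s i`. -/
theorem abs_sq_permanent_liftMatrix {B : Type*} [CommRing B] [Algebra ℂ B] {n : ℕ}
    (y : Fin n × (Fin 2 × Fin 2) → B) (hy : ∀ i, y i * y i = 0) (Λ : B →ₗ[ℂ] ℂ)
    (hΛ : Λ (∏ i, y i) = 1) (θ : Matrix (Fin n) (Fin n) ℂ) (s : Fin n → Fin n → Fin 2) :
    (∑ σ : Equiv.Perm (Fin n × Fin 2), ∏ t, liftMatrix θ s t (σ t)) *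
        starRingEnd ℂ (∑ σ : Equiv.Perm (Fin n × Fin 2), ∏ t, liftMatrix θ s t (σ t))
      = Λ (∏ i, ∑ J : Fin n × Fin n × Fin n × Fin n, rowProd (θ i) J •
        (y (J.1, 0, 0 + s i J.1) * y (J.2.1, 0, 1 + s i J.2.1) *
          (y (J.2.2.1, 1, 0 + s i J.2.2.1) * y (J.2.2.2, 1, 1 + s i J.2.2.2)))) := by
  have h1 : ∏ t, ∑ t', liftMatrix θ s t t' • y (t'.1, 0, t'.2)
      = (∑ σ : Equiv.Perm (Fin n × Fin 2), ∏ t, liftMatrix θ s t (σ t)) •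
        ∏ t : Fin n × Fin 2, y (t.1, 0, t.2) :=
    prod_sum_smul_eq_permanent _ _ fun j => hy _
  have h2 : ∏ t, ∑ t', liftMatrix (θ.map (starRingEnd ℂ)) s t t' • y (t'.1, 1, t'.2)
      = starRingEnd ℂ (∑ σ : Equiv.Perm (Fin n × Fin 2), ∏ t, liftMatrix θ s t (σ t)) •
        ∏ t : Fin n × Fin 2, y (t.1, 1, t.2) := by
    rw [prod_sum_smul_eq_permanent _ _ fun j => hy _]
    simp only [map_sum, map_prod, liftMatrix, apply_ite (starRingEnd ℂ), map_zero, Matrix.map_apply]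
  have hF : ∏ i, y i = (∏ t : Fin n × Fin 2, y (t.1, 0, t.2)) *
      ∏ t : Fin n × Fin 2, y (t.1, 1, t.2) := by
    simp only [Fintype.prod_prod_type, Fin.prod_univ_two, Finset.prod_mul_distrib]
    exact mul_mul_mul_comm _ _ _ _
  have h3 : ∀ i, ∑ J : Fin n × Fin n × Fin n × Fin n, rowProd (θ i) J •
        (y (J.1, 0, 0 + s i J.1) * y (J.2.1, 0, 1 + s i J.2.1) *
          (y (J.2.2.1, 1, 0 + s i J.2.2.1) * y (J.2.2.2, 1, 1 + s i J.2.2.2)))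
      = _ := fun i => (prod_four_sums_smul (θ i) (fun j => y (j, 0, 0 + s i j))
        (fun j => y (j, 0, 1 + s i j)) (fun j => y (j, 1, 0 + s i j))
        (fun j => y (j, 1, 1 + s i j))).symm
  simp only [h3]
  rw [Finset.prod_mul_distrib]
  have h4 : ∏ i, ((∑ j, θ i j • y (j, 0, 0 + s i j)) * ∑ j, θ i j • y (j, 0, 1 + s i j))
      = ∏ t, ∑ t', liftMatrix θ s t t' • y (t'.1, 0, t'.2) := by
    simp only [sum_liftMatrix_smul _ _ fun t : Fin n × Fin 2 => y (t.1, 0, t.2)]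
    rw [Fintype.prod_prod_type]
    simp only [Fin.prod_univ_two]
  have h5 : ∏ i, ((∑ j, starRingEnd ℂ (θ i j) • y (j, 1, 0 + s i j)) *
        ∑ j, starRingEnd ℂ (θ i j) • y (j, 1, 1 + s i j))
      = ∏ t, ∑ t', liftMatrix (θ.map (starRingEnd ℂ)) s t t' • y (t'.1, 1, t'.2) := by
    simp only [sum_liftMatrix_smul _ _ fun t : Fin n × Fin 2 => y (t.1, 1, t.2)]
    rw [Fintype.prod_prod_type]
    simp only [Fin.prod_univ_two, Matrix.map_apply]
  rw [h4, h5, h1, h2, smul_mul_smul_comm, ← hF, map_smul, hΛ, smul_eq_mul, mul_one]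

/-! ### Second moments of the partition sums -/

theorem ofReal_colouredSum_diagWeight (n m : ℕ) (a b : ℝ) :
    ((colouredSum n m (diagWeight n m a b) : ℝ) : ℂ)
      = colouredSum n m (diagWeight n m (a : ℂ) (b : ℂ)) := by
  simp only [colouredSum, diagWeight, Complex.ofReal_sum, apply_ite Complex.ofReal,
    Complex.ofReal_prod, Complex.ofReal_div, Complex.ofReal_natCast, Complex.ofReal_zero]

theorem ofReal_bigPsi (n m : ℕ) (hm : m ≠ 0) (a b : ℝ) :
    ((bigPsi n a b m : ℝ) : ℂ)
      = n.factorial * colouredSum n m (diagWeight n m (a : ℂ) (b : ℂ)) := by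
  rw [← ofReal_colouredSum_diagWeight, ← factorial_mul_cycleIndex n m hm, bigPsi]
  push_cast
  ring

section Moments

variable {Ω : Type*} [MeasurableSpace Ω] {P : Measure Ω} [IsProbabilityMeasure P] {D : Measure ℂ}
  [IsProbabilityMeasure D] {n : ℕ} {θ : Ω → Matrix (Fin n) (Fin n) ℂ}

theorem integral_Z_sq (h_fourth : Integrable (fun z : ℂ => ‖z‖ ^ 4) D)
    (h_law : ∀ i j, HasLaw (fun ω => θ ω i j) D P)
    (h_indep : iIndepFun (fun (ij : Fin n × Fin n) (ω : Ω) => θ ω ij.1 ij.2) P) (a b : ℝ)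
    (h10 : moment D 1 0 = 0) (h01 : moment D 0 1 = 0) (h22 : moment D 2 2 = a)
    (h20 : moment D 2 0 * moment D 0 2 = b) (h11 : moment D 1 1 * moment D 1 1 = b) :
    Integrable (fun ω => Z (θ ω) ^ 2) P ∧ ∫ ω, Z (θ ω) ^ 2 ∂P = (bigPsi n a b 3 : ℂ) := by
  obtain ⟨B, _, _, y, Λ, hy, hΛ⟩ := exists_squareZero_algebra (Fin n × Fin 4)
  simp only [Z_sq_eq y hy Λ hΛ]
  have key := integral_row_polynomials Λ h_fourth h_law h_indep a b h10 h01 h22 h20 h11 fun _ J =>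
    y (J.1, 0) * y (J.2.1, 1) * (y (J.2.2.1, 2) * y (J.2.2.2, 3))
  refine ⟨key.1, key.2.trans ?_⟩
  have h := row_four (a : ℂ) (b : ℂ) y hy
  rw [Fin.prod_const]
  simp only [Fintype.sum_prod_type]
  rw [h, map_smul, hΛ, smul_eq_mul, mul_one, ← ofReal_bigPsi n 3 (by norm_num)]
  norm_num

theorem integral_bethe_sq (h_fourth : Integrable (fun z : ℂ => ‖z‖ ^ 4) D)
    (h_law : ∀ i j, HasLaw (fun ω => θ ω i j) D P)
    (h_indep : iIndepFun (fun (ij : Fin n × Fin n) (ω : Ω) => θ ω ij.1 ij.2) P) (a b : ℝ)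
    (h10 : moment D 1 0 = 0) (h01 : moment D 0 1 = 0) (h22 : moment D 2 2 = a)
    (h20 : moment D 2 0 * moment D 0 2 = b) (h11 : moment D 1 1 * moment D 1 1 = b) :
    Integrable (fun ω => bethe 2 (θ ω) ^ 2) P ∧
      ∫ ω, bethe 2 (θ ω) ^ 2 ∂P = (bigPsi n a b 2 : ℂ) := by
  obtain ⟨B, _, _, y, Λ, hy, hΛ⟩ := exists_squareZero_algebra (Fin n × (Fin 2 × Fin 2))
  simp only [bethe_two_sq, abs_sq_permanent_liftMatrix y hy Λ hΛ]
  have key := fun s : Fin n → Fin n → Fin 2 =>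
    integral_row_polynomials Λ h_fourth h_law h_indep a b h10 h01 h22 h20 h11 fun i J =>
      y (J.1, 0, 0 + s i J.1) * y (J.2.1, 0, 1 + s i J.2.1) *
        (y (J.2.2.1, 1, 0 + s i J.2.2.1) * y (J.2.2.2, 1, 1 + s i J.2.2.2))
  refine ⟨(integrable_finsetSum _ fun s _ => (key s).1).const_mul _, ?_⟩
  rw [integral_const_mul, integral_finsetSum _ fun s _ => (key s).1,
    Finset.sum_congr rfl fun s _ => (key s).2]
  have h := row_two_cover (a : ℂ) (b : ℂ) y hy
  -- The normalization `2 ^ (n * n)` is split into one factor `2 ^ n` per row, matching the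
  -- factorization of the sum over `s` into independent sums over the rows of `s`.
  rw [← smul_eq_mul, ← map_sum, ← map_smul, pow_mul, ← inv_pow]
  have hexpand : ∑ s : Fin n → Fin n → Fin 2, ∏ i, ∑ J : Fin n × Fin n × Fin n × Fin n,
        pairing (a : ℂ) b J.1 J.2.1 J.2.2.1 J.2.2.2 •
          (y (J.1, 0, 0 + s i J.1) * y (J.2.1, 0, 1 + s i J.2.1) *
            (y (J.2.2.1, 1, 0 + s i J.2.2.1) * y (J.2.2.2, 1, 1 + s i J.2.2.2)))
      = (∑ s : Fin n → Fin 2, ∑ J : Fin n × Fin n × Fin n × Fin n,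
        pairing (a : ℂ) b J.1 J.2.1 J.2.2.1 J.2.2.2 •
          (y (J.1, 0, 0 + s J.1) * y (J.2.1, 0, 1 + s J.2.1) *
            (y (J.2.2.1, 1, 0 + s J.2.2.1) * y (J.2.2.2, 1, 1 + s J.2.2.2)))) ^ n := by
    rw [Fintype.sum_pow]
  rw [hexpand, ← smul_pow]
  simp only [Fintype.sum_prod_type]
  rw [h, map_smul, hΛ, smul_eq_mul, mul_one, ← ofReal_bigPsi n 2 (by norm_num)]
  norm_num

end Moments

/-! ### Distributions supported on a line -/

/-- Rotate by half the argument of `μ_{2,0}`, so that this moment becomes a non-negative real. Then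
`E[|z| ^ 2] - Re E[(v z) ^ 2] = 2 E[Im(v z) ^ 2]` vanishes, so `v z` is almost surely real. -/
theorem exists_line_of_norm_moment_eq (D : Measure ℂ) [IsProbabilityMeasure D]
    (h_fourth : Integrable (fun z : ℂ => ‖z‖ ^ 4) D)
    (h_eq : moment D 1 1 = (‖moment D 2 0‖ : ℂ)) :
    ∃ φ ∈ Set.Ioo (-Real.pi) Real.pi,
      ∀ᵐ z ∂D, ∃ r : ℝ, z = Complex.exp ((φ : ℂ) * Complex.I) * (r : ℂ) := by
  set ψ := (moment D 2 0).arg with hψ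
  have h1 := Complex.neg_pi_lt_arg (moment D 2 0)
  have h2 := Complex.arg_le_pi (moment D 2 0)
  have hpi := Real.pi_pos
  -- The argument lies in `(-π, π]`, so its half lies in the open interval.
  refine ⟨ψ / 2, ⟨by linarith, by linarith⟩, ?_⟩
  set u : ℂ := Complex.exp ((ψ / 2 : ℝ) * Complex.I) with hu
  set v : ℂ := Complex.exp (-((ψ / 2 : ℝ) * Complex.I)) with hv
  have huv : u * v = 1 := by rw [hu, hv, ← Complex.exp_add, add_neg_cancel, Complex.exp_zero]
  have hmom : v ^ 2 * moment D 2 0 = ‖moment D 2 0‖ := by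
    have h3 : moment D 2 0 = ‖moment D 2 0‖ * u ^ 2 := by
      conv_lhs => rw [← Complex.norm_mul_exp_arg_mul_I (moment D 2 0)]
      rw [hu, ← Complex.exp_nat_mul]
      congr 2
      push_cast
      ring
    rw [h3]
    simp only [norm_mul, Complex.norm_real, norm_norm]
    have h4 : ‖u ^ 2‖ = 1 := by rw [norm_pow, hu, Complex.norm_exp_ofReal_mul_I, one_pow]
    rw [h4]
    push_cast
    linear_combination (‖moment D 2 0‖ : ℂ) * (u * v + 1) * huv
  have hi11 : Integrable (fun z : ℂ => z ^ 1 * starRingEnd ℂ (z ^ 1)) D :=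
    integrable_pow_mul_conj h_fourth (by norm_num)
  have hi20 : Integrable (fun z : ℂ => v ^ 2 * (z ^ 2 * starRingEnd ℂ (z ^ 0))) D :=
    (integrable_pow_mul_conj h_fourth (by norm_num)).const_mul _
  have hdiff : ∀ z : ℂ, (z ^ 1 * starRingEnd ℂ (z ^ 1) - v ^ 2 * (z ^ 2 * starRingEnd ℂ (z ^ 0))).re
      = 2 * (v * z).im ^ 2 := by
    intro z
    have hz : z ^ 1 * starRingEnd ℂ (z ^ 1) = (v * z) * starRingEnd ℂ (v * z) := by
      have hvv : v * starRingEnd ℂ v = 1 := by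
        rw [Complex.mul_conj, Complex.normSq_eq_norm_sq, hv, ← neg_mul, ← Complex.ofReal_neg,
          Complex.norm_exp_ofReal_mul_I]
        norm_num
      rw [pow_one, map_mul]
      linear_combination (- z * starRingEnd ℂ z) * hvv
    rw [hz, show v ^ 2 * (z ^ 2 * starRingEnd ℂ (z ^ 0)) = (v * z) * (v * z) by
      rw [pow_zero, map_one]; ring]
    simp only [Complex.sub_re, Complex.mul_re (v * z), Complex.conj_re, Complex.conj_im]
    ring
  have hint : ∫ z, 2 * (v * z).im ^ 2 ∂D = 0 := by
    simp only [← hdiff]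
    have h5 := integral_re (hi11.sub hi20)
    refine h5.trans ?_
    simp only [Pi.sub_apply]
    rw [integral_sub hi11 hi20, integral_const_mul]
    change RCLike.re (moment D 1 1 - v ^ 2 * moment D 2 0) = 0
    rw [hmom, h_eq, sub_self, map_zero]
  have hii : Integrable (fun z : ℂ => 2 * (v * z).im ^ 2) D := by
    simp only [← hdiff]
    exact (hi11.sub hi20).re
  have hae := (integral_eq_zero_iff_of_nonneg (fun z => by positivity) hii).1 hint
  filter_upwards [hae] with z hz
  have him : (v * z).im = 0 := by simpa using hz
  refine ⟨(v * z).re, ?_⟩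
  rw [show (((v * z).re : ℝ) : ℂ) = v * z from Complex.ext (by simp) (by simpa using him.symm)]
  linear_combination (- z) * huv

end DENFG

theorem mainTheorem7
    (D : Measure ℂ) [IsProbabilityMeasure D]
    (h_fourth : Integrable (fun z : ℂ => ‖z‖ ^ 4) D)
    (h_mean : DENFG.moment D 1 0 = 0)
    (h_eq : DENFG.moment D 1 1 = (‖DENFG.moment D 2 0‖ : ℂ))
    (h_pos : 0 < ‖DENFG.moment D 2 0‖)
    {Ω : ℕ → Type*} [∀ n, MeasurableSpace (Ω n)]
    (P : ∀ n, Measure (Ω n)) [∀ n, IsProbabilityMeasure (P n)]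
    (θ : ∀ n, Ω n → Matrix (Fin n) (Fin n) ℂ)
    (h_law : ∀ n i j, HasLaw (fun ω => θ n ω i j) D (P n))
    (h_indep : ∀ n,
      iIndepFun (fun (ij : Fin n × Fin n) (ω : Ω n) => θ n ω ij.1 ij.2) (P n))
    (a b : ℝ) (ha : a = (DENFG.moment D 2 2).re) (hb : b = (DENFG.moment D 1 1).re ^ 2) :
    (∃ φ ∈ Set.Ioo (-Real.pi) Real.pi,
      ∀ᵐ z ∂D, ∃ r : ℝ, z = Complex.exp ((φ : ℂ) * Complex.I) * (r : ℂ)) ∧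
    (∀ n : ℕ, 1 ≤ n →
      (Integrable (fun ω => DENFG.Z (θ n ω) ^ 2) (P n) ∧
        ∫ ω, DENFG.Z (θ n ω) ^ 2 ∂(P n) = (DENFG.bigPsi n a b 3 : ℂ) ∧
        ∫ ω, DENFG.Z (θ n ω) ^ 2 ∂(P n) =
          (DENFG.smallPsi n a b 2 (‖DENFG.moment D 2 0‖ ^ 2) : ℂ)) ∧
      (Integrable (fun ω => DENFG.bethe 2 (θ n ω) ^ 2) (P n) ∧
        ∫ ω, DENFG.bethe 2 (θ n ω) ^ 2 ∂(P n) = (DENFG.bigPsi n a b 2 : ℂ) ∧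
        ∫ ω, DENFG.bethe 2 (θ n ω) ^ 2 ∂(P n) =
          (DENFG.smallPsi n a b 1 (‖DENFG.moment D 2 0‖ ^ 2) : ℂ))) ∧
    Tendsto (fun n : ℕ =>
      ((∫ ω, DENFG.Z (θ n ω) ^ 2 ∂(P n)) /
          (∫ ω, DENFG.bethe 2 (θ n ω) ^ 2 ∂(P n))) ^ (1 / 2 : ℂ) /
        ((√((1 / Real.exp 1) *
          ((((n : ℝ) + 2) * ((n : ℝ) + 1) / 2 - (a - 3 * b) * ((n : ℝ) + 1) / b
              + (a - 3 * b) ^ 2 / (2 * b ^ 2)) /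
            (((n : ℝ) + 1) - (a - 2 * b) / b))) : ℝ) : ℂ))
      atTop (𝓝 1) := by
  have hconj : ∀ p q, DENFG.moment D q p = starRingEnd ℂ (DENFG.moment D p q) := by
    intro p q
    rw [DENFG.moment, DENFG.moment, ← integral_conj]
    simp only [map_mul, Complex.conj_conj, mul_comm]
  have hb' : b = ‖DENFG.moment D 2 0‖ ^ 2 := by rw [hb, h_eq, Complex.ofReal_re]
  have hb0 : 0 < b := by rw [hb']; positivity
  have hmul : ∀ z : ℂ, z ^ 2 * starRingEnd ℂ (z ^ 2) = ((‖z‖ ^ 4 : ℝ) : ℂ) := by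
    intro z
    rw [Complex.mul_conj, Complex.normSq_eq_norm_sq, norm_pow, ← pow_mul]
  have hm22 : DENFG.moment D 2 2 = ((∫ z, ‖z‖ ^ 4 ∂D : ℝ) : ℂ) := by
    rw [DENFG.moment]
    simp only [hmul]
    exact integral_ofReal
  have h22 : DENFG.moment D 2 2 = a := by rw [ha, hm22, Complex.ofReal_re]
  have ha0 : 0 ≤ a := by
    rw [ha, hm22, Complex.ofReal_re]
    exact integral_nonneg fun z => by positivity
  have h01 : DENFG.moment D 0 1 = 0 := by rw [hconj, h_mean, map_zero]
  have h20 : DENFG.moment D 2 0 * DENFG.moment D 0 2 = b := by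
    rw [hconj 2 0, Complex.mul_conj, Complex.normSq_eq_norm_sq, hb']
  have h11 : DENFG.moment D 1 1 * DENFG.moment D 1 1 = b := by
    rw [h_eq, hb']
    push_cast
    ring
  have hZ := fun n => DENFG.integral_Z_sq h_fourth (h_law n) (h_indep n) a b h_mean h01 h22 h20 h11
  have hB := fun n =>
    DENFG.integral_bethe_sq h_fourth (h_law n) (h_indep n) a b h_mean h01 h22 h20 h11
  -- Here `c = |μ_{2,0}| ^ 2 = b`, so the extra `c ^ k` amounts to one more colour.
  have hψ : ∀ n m : _, DENFG.smallPsi n a b m (‖DENFG.moment D 2 0‖ ^ 2)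
      = DENFG.bigPsi n a b (m + 1) := by
    intro n m
    rw [← hb', DENFG.smallPsi, DENFG.bigPsi]
    simp only [add_mul, one_mul]
  refine ⟨DENFG.exists_line_of_norm_moment_eq D h_fourth h_eq, fun n _ =>
    ⟨⟨(hZ n).1, (hZ n).2, ?_⟩, (hB n).1, (hB n).2, ?_⟩, ?_⟩
  · rw [hψ, (hZ n).2]
    norm_num
  · rw [hψ, (hB n).2]
    norm_num
  · simp only [fun n => (hZ n).2, fun n => (hB n).2]
    exact DENFG.tendsto_sqrt_bigPsi_ratio a b ha0 hb0
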